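/- **Proposition (Reservoir Lemma).** For an integer $r\ge 1$, an *$r$-path* in a graph $H$ is a sequence of distinct vertices $v_1,\dots,v_m$ such that $v_iv_j\in E(H)$ whenever $0<|i-j|\le r$ (i.e. the $r$-th power of a path). It *connects* the ordered $r$-cliques $K$ and $K'$ if $K=(v_1,\dots,v_r)$ and $K'=(v_{m-r+1},\dots,v_m)$ are disjoint; the other vertices are its *internal* vertices. An ordered $r$-clique of a graph is a sequence of $r$ distinct, pairwise adjacent vertices. Let $G(n,p)$ denote the binomial random graph on $\{1,\dots,n\}$ with edge probability $p$. For every integer $k\ge 0$, every $\varepsilon>0$ and every $\gamma\in(0,1)$ there exists $C>1$ such that the following holds. For every sequence $(G_n)_{n\in\mathbb N}$ of graphs, $G_n$ having vertex set $\{1,\dots,n\}$, with $\delta(G_n)\ge\left(\frac{k}{k+1}+\varepsilon\right)n$ for all sufficiently large $n$, there are sets $R_n\subseteq\{1,\dots,n\}$ of size $|R_n|=\lfloor\gamma^2n\rfloor$ such that for every $p\colon\mathbb N\to[0,1]$ with $p(n)\ge C/n$ for all sufficiently large $n$, the probability that $H_n=G_n\cup G(n,p(n))$ has the following property tends to $1$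 as $n\to\infty$: For every $S\subseteq R_n$ with $|S|\le\varepsilon|R_n|/4$ and every pair of disjoint ordered $(k+1)$-cliques $K,K'$ in $G_n-R_n$, there exists a $(k+1)$-path in $H_n$ that connects $K$ and $K'$ and has exactly $(k+1)2^{k+1}$ internal vertices, all of which belong to $R_n\setminus S$. -/

import Mathlib

open Filter Topology

/-- An ordered `m`-clique `K 0, …, K (m - 1)` of the graph `G`
(pairwise adjacency makes the vertices distinct). -/
def IsOrderedClique {V : Type*} (G : SimpleGraph V) {m : ℕ} (K : Fin m → V) : Prop :=
  ∀ i j : Fin m, i ≠ j → G.Adj (K i) (K j)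

/-- The vertex sequence `P 0, …, P (m - 1)` is an `r`-path in `H`, that is, the `r`-th power of a
path: its vertices are distinct, and any two of them at distance at most `r` along the path are
adjacent in `H`. -/
def IsPowerPath {V : Type*} (H : SimpleGraph V) (r : ℕ) {m : ℕ} (P : Fin m → V) : Prop :=
  Function.Injective P ∧
    ∀ i j : Fin m, i < j → (j : ℕ) ≤ (i : ℕ) + r → H.Adj (P i) (P j)

/-- Some `r`-path of `H`, whose first `r` vertices are `K` and whose last `r` vertices are `K'`
(in this order), has exactly `l` internal vertices, all of which lie in `W`. -/
def IsConnectedThrough {V : Type*} (H : SimpleGraph V) (r l : ℕ) (W : Finset V)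
    (K K' : Fin r → V) : Prop :=
  ∃ Q : Fin l → V, (∀ i, Q i ∈ W) ∧ IsPowerPath H r (Fin.append (Fin.append K Q) K')

/-- The reservoir property of `R`, with base graph `G` and augmented graph `H`: after deleting any
`S ⊆ R` with `|S| ≤ ε |R| / 4`, any two disjoint ordered `(k+1)`-cliques of `G - R` are connected
by a `(k+1)`-path of `H` with exactly `(k+1) 2 ^ (k+1)` internal vertices, all in `R \ S`. -/
def IsReservoir {V : Type*} [DecidableEq V] (k : ℕ) (ε : ℝ) (G H : SimpleGraph V)
    (R : Finset V) : Prop :=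
  ∀ S : Finset V, S ⊆ R → (S.card : ℝ) ≤ ε * (R.card : ℝ) / 4 →
    ∀ K K' : Fin (k + 1) → V, IsOrderedClique G K → IsOrderedClique G K' →
      (∀ i, K i ∉ R) → (∀ i, K' i ∉ R) → (∀ i j, K i ≠ K' j) →
        IsConnectedThrough H (k + 1) ((k + 1) * 2 ^ (k + 1)) (R \ S) K K'

/-! Put `r = k + 1`. By the degree condition any `r` vertices of `G` have linearly many common
neighbours. A reservoir chosen by Hoeffding's inequality (`exists_card_inter_le`) meets every
non-neighbourhood in about the expected proportion, so the same holds inside `R \ S` for every small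
`S` (`le_card_common_neighbors`).

With at most `r` constraints per new vertex, an `r`-path can be extended greedily in `G` but not
steered to a prescribed clique. Giving up adjacency at distance exactly `r` frees one constraint per
vertex in each block, and this suffices for steering. Choose a clique `y` first. Starting at `K`,
block `t` ends with the last `t` vertices of `y`, so after `r` blocks only `y` remains. The same is
done backwards from `K'`, and `y` is repeated in between. Such scaffolds form a positive proportion
of all assignments (`pow_le_card_isScaffold`). The resulting walk repeats vertices of `y`.
Supersaturation cures this: a dense family of assignments has densely many blow-ups, in which every
visit to a label can use its own copy (`exists_dense_isPullback`). Hence a positive proportion of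
all sequences are injective walks that lack only the edges at distance `r`
(`exists_dense_isSparseWalk`).

The random graph supplies those edges: a dense family contains a sequence with all its distance-`r`
pairs joined, except with exponentially small probability
(`exists_binomialRandom_real_not_hasLinkedSequence`). The induction removes the last entry: one
random graph joins it to its predecessor for a positive proportion of the prefixes, and a second,
independent one deals with these prefixes. The failure probability, of order `exp (-2n)`, survives a
union bound over at most `2 ^ n` sets `S` and `n ^ (2r)` pairs of cliques. -/

/-! ### Greedy counting and dense relations -/

open scoped Classical in
/-- Greedy counting: if every prefix of a sequence has at least `c` admissible extensions, then
there are at least `c ^ M` admissible sequences of length `M`. -/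
theorem pow_le_card_of_forall_extension {A : Type*} [Fintype A] [Nonempty A] (c : ℕ) (M : ℕ)
    (P : Fin M → (Fin M → A) → Prop)
    (hloc : ∀ m h h', (∀ i ≤ m, h i = h' i) → P m h → P m h')
    (hc : ∀ m h, c ≤ (Finset.univ.filter fun v : A => P m (Function.update h m v)).card) :
    c ^ M ≤ (Finset.univ.filter fun h : Fin M → A => ∀ m, P m h).card := by
  induction M with
  | zero => simp
  | succ M ih =>
    -- A filler for the last coordinate. By `hloc` the conditions on earlier coordinates do not see
    -- it.
    let d : A := Classical.arbitrary A
    let P' : Fin M → (Fin M → A) → Prop := fun m h => P m.castSucc (Fin.snoc (α := fun _ => A) h d)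
    have h1 := ih P' (by
      intro m h h' hh
      apply hloc
      intro i hi
      have hi' : i ≠ Fin.last M := by
        rintro rfl
        exact absurd hi (by simp [Fin.le_def])
      obtain ⟨i, rfl⟩ := Fin.exists_castSucc_eq.2 hi'
      simpa using hh i (by simpa using hi)) (by
      intro m h
      refine (hc m.castSucc (Fin.snoc (α := fun _ => A) h d)).trans (Finset.card_le_card ?_)
      intro v hv
      simp only [Finset.mem_filter, Finset.mem_univ, true_and, P'] at hv ⊢
      rwa [← Fin.snoc_update] at hv)
    set S' := Finset.univ.filter fun h : Fin M → A => ∀ m, P' m h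
    let E : (Fin M → A) → Finset A := fun h =>
      Finset.univ.filter fun v : A => P (Fin.last M) (Fin.snoc (α := fun _ => A) h v)
    have hE : ∀ h, c ≤ (E h).card := by
      intro h
      refine (hc (Fin.last M) (Fin.snoc (α := fun _ => A) h d)).trans (Finset.card_le_card ?_)
      intro v hv
      simpa [E, Fin.update_snoc_last] using hv
    have h2 : c ^ (M + 1) ≤ (S'.sigma E).card := by
      rw [Finset.card_sigma, pow_succ]
      calc c ^ M * c ≤ S'.card * c := Nat.mul_le_mul_right _ h1
        _ = ∑ _h ∈ S', c := by simp
        _ ≤ _ := Finset.sum_le_sum fun h _ => hE h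
    refine h2.trans (Finset.card_le_card_of_injOn
      (fun x => (Fin.snoc (α := fun _ => A) x.1 x.2 : Fin (M + 1) → A)) ?_ ?_)
    · rintro ⟨h, v⟩ hx
      simp only [Finset.coe_sigma, Set.mem_sigma_iff, Finset.mem_coe, S', E, Finset.mem_filter,
        Finset.mem_univ, true_and] at hx
      simp only [Finset.coe_filter, Finset.mem_univ, true_and, Set.mem_ofPred_eq]
      intro m
      induction m using Fin.lastCases with
      | last => exact hx.2
      | cast m =>
        refine hloc _ _ _ ?_ (hx.1 m)
        intro i hi
        have hi' : i ≠ Fin.last M := by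
          rintro rfl
          exact absurd hi (by simp [Fin.le_def])
        obtain ⟨i, rfl⟩ := Fin.exists_castSucc_eq.2 hi'
        simp
    · rintro ⟨h, v⟩ _ ⟨h', v'⟩ _ hh
      simp only at hh
      obtain ⟨rfl, rfl⟩ := Fin.snoc_injective2 hh
      rfl

open scoped Classical in
/-- In a dense bipartite relation many elements have large degree. -/
theorem half_mul_card_le_card_heavy {X Y : Type*} [Fintype X] [Fintype Y] [Nonempty Y]
    (P : X → Y → Prop) {β : ℝ} (hβ : 0 ≤ β)
    (h : β * Fintype.card X * Fintype.card Y ≤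
      ((Finset.univ.filter fun p : X × Y => P p.1 p.2).card : ℝ)) :
    β / 2 * Fintype.card X ≤ ((Finset.univ.filter fun x : X =>
      β / 2 * Fintype.card Y ≤ ((Finset.univ.filter fun y : Y => P x y).card : ℝ)).card : ℝ) := by
  set deg : X → ℝ := fun x => ((Finset.univ.filter fun y : Y => P x y).card : ℝ) with hdeg
  have hsum : ((Finset.univ.filter fun p : X × Y => P p.1 p.2).card : ℝ) = ∑ x, deg x := by
    simp only [hdeg]
    rw [← Nat.cast_sum]
    congr 1
    simp only [Finset.card_filter]
    rw [← Finset.univ_product_univ, Finset.sum_product]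
  have hY : (0 : ℝ) < Fintype.card Y := by exact_mod_cast Fintype.card_pos
  have hdY : ∀ x, deg x ≤ Fintype.card Y := fun x => by
    simp only [hdeg]; exact_mod_cast Finset.card_le_univ _
  set Hv := Finset.univ.filter fun x : X => β / 2 * Fintype.card Y ≤ deg x with hHv
  have hle : ∑ x, deg x ≤ Hv.card * Fintype.card Y + Fintype.card X * (β / 2 * Fintype.card Y) := by
    calc ∑ x, deg x ≤ ∑ x, ((if x ∈ Hv then (Fintype.card Y : ℝ) else 0)
          + β / 2 * Fintype.card Y) := by
          refine Finset.sum_le_sum fun x _ => ?_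
          split_ifs with hx
          · have := hdY x
            have : 0 ≤ β / 2 * Fintype.card Y := by positivity
            linarith [hdY x]
          · simp only [hHv, Finset.mem_filter, Finset.mem_univ, true_and, not_le] at hx
            linarith
      _ = _ := by
          rw [Finset.sum_add_distrib]
          simp
  rw [hsum] at h
  have : β / 2 * Fintype.card X * Fintype.card Y ≤ Hv.card * Fintype.card Y := by linarith
  exact le_of_mul_le_mul_right this hY

open scoped Classical in
theorem card_filter_prod_comm {X Y : Type*} [Fintype X] [Fintype Y] (P : X → Y → Prop) :
    (Finset.univ.filter fun p : X × Y => P p.1 p.2).card =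
      (Finset.univ.filter fun p : Y × X => P p.2 p.1).card := by
  refine Finset.card_bij (fun p _ => (p.2, p.1)) (by simp) ?_ (by simp)
  rintro ⟨a, b⟩ _ ⟨c, d⟩ _ h
  simp at h
  simp [h]

open scoped Classical in
/-- If all elements of a large set have large degree, then the relation is dense. -/
theorem mul_le_card_of_heavy {X Y : Type*} [Fintype X] [Fintype Y] (P : X → Y → Prop)
    {a b : ℝ} (hb : 0 ≤ b) (Q : X → Prop)
    (hQ : a ≤ ((Finset.univ.filter fun x : X => Q x).card : ℝ))
    (h : ∀ x, Q x → b ≤ ((Finset.univ.filter fun y : Y => P x y).card : ℝ)) :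
    a * b ≤ ((Finset.univ.filter fun p : X × Y => P p.1 p.2).card : ℝ) := by
  have hsum : ((Finset.univ.filter fun p : X × Y => P p.1 p.2).card : ℝ)
      = ∑ x, ((Finset.univ.filter fun y : Y => P x y).card : ℝ) := by
    rw [← Nat.cast_sum]
    congr 1
    simp only [Finset.card_filter]
    rw [← Finset.univ_product_univ, Finset.sum_product]
  rw [hsum]
  calc a * b ≤ (Finset.univ.filter fun x : X => Q x).card * b := by gcongr
    _ = ∑ x ∈ Finset.univ.filter (fun x : X => Q x), b := by simp
    _ ≤ ∑ x ∈ Finset.univ.filter (fun x : X => Q x),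
        ((Finset.univ.filter fun y : Y => P x y).card : ℝ) :=
        Finset.sum_le_sum fun x hx => h x (by simpa using hx)
    _ ≤ _ := Finset.sum_le_sum_of_subset_of_nonneg (Finset.filter_subset _ _)
        fun _ _ _ => by positivity

/-! ### Blow-ups of dense families -/

open scoped Classical in
/-- Dense `s`-partite `s`-uniform hypergraphs contain a positive proportion of all complete
`s`-partite subgraphs with parts of size `t`. -/
theorem exists_dense_blowup (s t : ℕ) (β : ℝ) (hβ : 0 < β) :
    ∃ β' : ℝ, 0 < β' ∧ ∀ (V : Type) [Fintype V] [Nonempty V] (T : Finset (Fin s → V)),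
      β * (Fintype.card V : ℝ) ^ s ≤ (T.card : ℝ) →
      β' * (Fintype.card V : ℝ) ^ (s * t) ≤ ((Finset.univ.filter fun z : Fin s → Fin t → V =>
        ∀ c : Fin s → Fin t, (fun p => z p (c p)) ∈ T).card : ℝ) := by
  induction s generalizing β with
  | zero =>
    refine ⟨1, one_pos, fun V _ _ T hT => ?_⟩
    have hpos : 0 < T.card := by
      have : (0 : ℝ) < T.card := lt_of_lt_of_le (by simpa using hβ) hT
      exact_mod_cast this
    obtain ⟨x, hx⟩ := Finset.card_pos.1 hpos
    have : ∀ y : Fin 0 → V, y ∈ T := fun y => by rwa [Subsingleton.elim y x]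
    simp [this]
  | succ s ih =>
    -- A proportion `β / 2` of the tails `x` have at least `β / 2 * n` first entries, hence `(β / 2
    -- * n) ^ t` tuples of `t` such entries. So tails and tuples are related with density `β₁`. A
    -- proportion `β₁ / 2` of the tuples then have a dense set of common tails, and induction
    -- applies to that set.
    set β₁ : ℝ := (β / 2) * (β / 2) ^ t with hβ₁
    have hβ₁pos : 0 < β₁ := by positivity
    obtain ⟨β', hβ', H⟩ := ih (β₁ / 2) (by positivity)
    refine ⟨β₁ / 2 * β', by positivity, fun V _ _ T hT => ?_⟩
    set n : ℝ := (Fintype.card V : ℝ) with hn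
    have hn0 : 0 ≤ n := by positivity
    have hT' : β * Fintype.card (Fin s → V) * Fintype.card V ≤
        ((Finset.univ.filter fun p : (Fin s → V) × V =>
          (Fin.cons p.2 p.1 : Fin (s + 1) → V) ∈ T).card : ℝ) := by
      have e1 : ((Finset.univ.filter fun p : (Fin s → V) × V =>
          (Fin.cons p.2 p.1 : Fin (s + 1) → V) ∈ T).card) = T.card := by
        refine Finset.card_bij (fun p _ => (Fin.cons p.2 p.1 : Fin (s + 1) → V))
          (by simp) ?_ ?_
        · rintro ⟨a, b⟩ _ ⟨c, d⟩ _ h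
          obtain ⟨rfl, rfl⟩ := Fin.cons_injective2 h
          rfl
        · intro x hx
          exact ⟨(Fin.tail x, x 0), by simpa using hx, by simp⟩
      rw [e1]
      simp only [Fintype.card_fun, Fintype.card_fin, Nat.cast_pow]
      rw [pow_succ] at hT
      linarith
    have hheavy := half_mul_card_le_card_heavy (fun (x : Fin s → V) (y : V) =>
      (Fin.cons y x : Fin (s + 1) → V) ∈ T) hβ.le (by convert hT')
    have hpair := mul_le_card_of_heavy (X := Fin s → V) (Y := Fin t → V)
      (fun x y => ∀ i, (Fin.cons (y i) x : Fin (s + 1) → V) ∈ T)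
      (b := (β / 2 * n) ^ t) (by positivity) _ hheavy (by
        intro x hx
        have e2 : (Finset.univ.filter fun y : Fin t → V =>
            ∀ i, (Fin.cons (y i) x : Fin (s + 1) → V) ∈ T) =
            Fintype.piFinset fun _ : Fin t =>
              (Finset.univ.filter fun y : V => (Fin.cons y x : Fin (s + 1) → V) ∈ T) := by
          ext y; simp [Fintype.mem_piFinset]
        have e2' := congrArg Finset.card e2
        rw [Fintype.card_piFinset] at e2'
        simp only [Finset.prod_const, Finset.card_univ, Fintype.card_fin] at e2'
        have := pow_le_pow_left₀ (by positivity) hx t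
        convert! this using 1
        rw [← Nat.cast_pow]
        congr 1
        convert! e2')
    rw [card_filter_prod_comm (X := Fin s → V) (Y := Fin t → V)
      (fun x y => ∀ i, (Fin.cons (y i) x : Fin (s + 1) → V) ∈ T)] at hpair
    have hheavy2 := half_mul_card_le_card_heavy (X := Fin t → V) (Y := Fin s → V) (β := β₁)
      (fun y x => ∀ i, (Fin.cons (y i) x : Fin (s + 1) → V) ∈ T) hβ₁pos.le (by
        refine le_trans (le_of_eq ?_) hpair
        simp only [Fintype.card_fun, Fintype.card_fin, Nat.cast_pow, hβ₁, ← hn]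
        ring)
    have hfin := mul_le_card_of_heavy (X := Fin t → V) (Y := Fin s → Fin t → V)
      (fun y z => ∀ c : Fin s → Fin t, ∀ i, (Fin.cons (y i) (fun p => z p (c p)) :
        Fin (s + 1) → V) ∈ T) (b := β' * n ^ (s * t)) (by positivity) _ hheavy2 (by
        intro y hy
        have := H V (Finset.univ.filter fun x : Fin s → V =>
          ∀ i, (Fin.cons (y i) x : Fin (s + 1) → V) ∈ T) (by
            simp only [Fintype.card_fun, Fintype.card_fin, Nat.cast_pow] at hy
            convert! hy)
        simp only [Finset.mem_filter, Finset.mem_univ, true_and] at this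
        convert! this)
    have e3 : (Finset.univ.filter fun p : (Fin t → V) × (Fin s → Fin t → V) =>
        ∀ c : Fin s → Fin t, ∀ i, (Fin.cons (p.1 i) (fun q => p.2 q (c q)) :
        Fin (s + 1) → V) ∈ T).card ≤ (Finset.univ.filter fun z : Fin (s + 1) → Fin t → V =>
        ∀ c : Fin (s + 1) → Fin t, (fun p => z p (c p)) ∈ T).card := by
      refine Finset.card_le_card_of_injOn
        (fun p => (Fin.cons p.1 p.2 : Fin (s + 1) → Fin t → V)) ?_ ?_
      · rintro ⟨y, z⟩ h
        simp only [Finset.coe_filter, Finset.mem_univ, true_and, Set.mem_ofPred_eq] at h ⊢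
        intro c
        convert h (fun q => c q.succ) (c 0) using 1
        funext q
        induction q using Fin.cases with
        | zero => simp
        | succ q => simp
      · rintro ⟨a, b⟩ _ ⟨c, d⟩ _ h
        obtain ⟨rfl, rfl⟩ := Fin.cons_injective2 h
        rfl
    refine le_trans (le_of_eq ?_) (hfin.trans (by rw [Nat.cast_le]; convert! e3))
    simp only [Fintype.card_fun, Fintype.card_fin, Nat.cast_pow, ← hn]
    ring

/-- The sequence `x` is compatible, along the labelling `φ`, with the family `T` of assignments:
all unary and all irreflexive binary relations that hold between labels throughout `T` hold between
the corresponding entries of `x`. -/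
def IsPullback {ι V : Type*} {L : ℕ} (T : Finset (ι → V)) (φ : Fin L → ι) (x : Fin L → V) : Prop :=
  (∀ (i j : Fin L) (R : V → V → Prop), (∀ v, ¬ R v v) →
    (∀ h ∈ T, R (h (φ i)) (h (φ j))) → R (x i) (x j)) ∧
  ∀ (i : Fin L) (U : V → Prop), (∀ h ∈ T, U (h (φ i))) → U (x i)

-- Blow up every label into `L` copies and let position `i` use the `i`-th copy of its label. Two
-- positions with different labels then lie in a common member of `T`. Two positions with equal
-- labels satisfy the condition vacuously, since no irreflexive relation holds between a label and
-- itself throughout the nonempty family `T`.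
open scoped Classical in
theorem exists_dense_isPullback_fin (s L : ℕ) (β : ℝ) (hβ : 0 < β) :
    ∃ β' : ℝ, 0 < β' ∧ ∀ (V : Type) [Fintype V] [Nonempty V] (T : Finset (Fin s → V))
      (φ : Fin L → Fin s), β * (Fintype.card V : ℝ) ^ s ≤ (T.card : ℝ) →
      β' * (Fintype.card V : ℝ) ^ L ≤
        ((Finset.univ.filter fun x : Fin L → V => IsPullback T φ x).card : ℝ) := by
  obtain ⟨β', hβ', H⟩ := exists_dense_blowup s L β hβ
  refine ⟨β', hβ', fun V _ _ T φ hT => ?_⟩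
  have h1 := H V T hT
  set Z := Finset.univ.filter fun z : Fin s → Fin L → V =>
    ∀ c : Fin s → Fin L, (fun p => z p (c p)) ∈ T with hZ
  set n := Fintype.card V with hn
  have hn0 : 0 < n := Fintype.card_pos
  let f : (Fin s → Fin L → V) → Fin L → V := fun z i => z (φ i) i
  -- The value `f z` determines `L` of the `s * L` entries of `z`, and the others are free.
  have hfib : ∀ a ∈ Z.image f, (Z.filter fun z => f z = a).card ≤ n ^ ((s - 1) * L) := by
    intro a _
    let B : Fin s → Fin L → Finset V := fun p i => if p = φ i then {a i} else Finset.univ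
    have hsub : (Z.filter fun z => f z = a) ⊆
        Fintype.piFinset fun p => Fintype.piFinset (B p) := by
      intro z hz
      simp only [Finset.mem_filter] at hz
      simp only [Fintype.mem_piFinset, B]
      intro p i
      split_ifs with h
      · subst h
        simpa [f] using congrFun hz.2 i
      · simp
    refine (Finset.card_le_card hsub).trans (le_of_eq ?_)
    simp only [Fintype.card_piFinset]
    rw [Finset.prod_comm]
    have : ∀ i : Fin L, ∏ p : Fin s, (B p i).card = n ^ (s - 1) := by
      intro i
      simp only [B, apply_ite Finset.card, Finset.card_singleton, Finset.card_univ]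
      rw [Finset.prod_ite]
      simp [Finset.filter_ne', hn]
    simp [this, pow_mul]
  have h2 := Finset.card_le_mul_card_image Z _ hfib
  have h3 : Z.image f ⊆ Finset.univ.filter fun x : Fin L → V => IsPullback T φ x := by
    intro x hx
    obtain ⟨z, hz, rfl⟩ := Finset.mem_image.1 hx
    simp only [hZ, Finset.mem_filter, Finset.mem_univ, true_and] at hz ⊢
    refine ⟨fun i j R hR h => ?_, fun i U h => h _ (hz fun _ => i)⟩
    have hne : φ i ≠ φ j := by
      intro he
      have := h _ (hz fun _ => i)
      rw [he] at this
      exact hR _ this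
    -- Copy `i` in part `φ i` and copy `j` in all other parts: this member of `T` contains both `x
    -- i` and `x j`.
    have := h _ (hz fun p => if p = φ i then i else j)
    simpa [hne.symm, f] using this
  have h4 : (n : ℝ) ^ ((s - 1) * L) * (β' * (n : ℝ) ^ L) ≤ (n : ℝ) ^ ((s - 1) * L) *
      ((Finset.univ.filter fun x : Fin L → V => IsPullback T φ x).card : ℝ) := by
    -- For `L = 0` there may be no labels, and `s - 1` would be truncated.
    rcases Nat.eq_zero_or_pos L with rfl | hL
    · simp only [mul_zero, pow_zero, one_mul, mul_one] at h1 h2 ⊢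
      refine h1.trans ?_
      exact_mod_cast h2.trans (Finset.card_le_card h3)
    · have hs : 1 ≤ s := Nat.one_le_of_lt (φ ⟨0, hL⟩).2
      have e : (s - 1) * L + L = s * L := by
        obtain ⟨s, rfl⟩ := Nat.exists_eq_add_of_le hs
        simp; ring
      have : (n : ℝ) ^ ((s - 1) * L) * (β' * (n : ℝ) ^ L) = β' * (n : ℝ) ^ (s * L) := by
        rw [← e, pow_add]; ring
      rw [this]
      refine h1.trans ?_
      exact_mod_cast h2.trans (Nat.mul_le_mul_left _ (Finset.card_le_card h3))
  exact le_of_mul_le_mul_left h4 (by positivity)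

open scoped Classical in
/-- A dense family of assignments of vertices to labels can be blown up to a dense family of
sequences with prescribed labels. -/
theorem exists_dense_isPullback (ι : Type) [Fintype ι] (L : ℕ) (β : ℝ) (hβ : 0 < β) :
    ∃ β' : ℝ, 0 < β' ∧ ∀ (V : Type) [Fintype V] [Nonempty V] (T : Finset (ι → V))
      (φ : Fin L → ι), β * (Fintype.card V : ℝ) ^ (Fintype.card ι) ≤ (T.card : ℝ) →
      β' * (Fintype.card V : ℝ) ^ L ≤
        ((Finset.univ.filter fun x : Fin L → V => IsPullback T φ x).card : ℝ) := by
  obtain ⟨β', hβ', H⟩ := exists_dense_isPullback_fin (Fintype.card ι) L β hβ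
  refine ⟨β', hβ', fun V _ _ T φ hT => ?_⟩
  let e := Fintype.equivFin ι
  let T' : Finset (Fin (Fintype.card ι) → V) := T.image fun h => h ∘ e.symm
  have hc : T'.card = T.card := Finset.card_image_of_injective _ fun a b hab => by
    funext i
    simpa using congrFun hab (e i)
  have := H V T' (e ∘ φ) (by rwa [hc])
  refine this.trans ?_
  norm_cast
  refine Finset.card_le_card fun x hx => ?_
  simp only [Finset.mem_filter, Finset.mem_univ, true_and] at hx ⊢
  refine ⟨fun i j R hR h => hx.1 i j R hR ?_, fun i U h => hx.2 i U ?_⟩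
  · intro g hg
    obtain ⟨g, hg', rfl⟩ := Finset.mem_image.1 hg
    simpa using h g hg'
  · intro g hg
    obtain ⟨g, hg', rfl⟩ := Finset.mem_image.1 hg
    simpa using h g hg'

open scoped Classical in
/-- All but `L ^ 2 * n ^ (L - 1)` of the sequences of length `L` are injective. -/
theorem card_sub_le_card_injective {V : Type*} [Fintype V] (L : ℕ) (Q : (Fin L → V) → Prop) :
    (Finset.univ.filter fun x => Q x).card ≤
      (Finset.univ.filter fun x => Q x ∧ Function.Injective x).card
        + L ^ 2 * Fintype.card V ^ (L - 1) := by
  have hsub : (Finset.univ.filter fun x => Q x) ⊆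
      (Finset.univ.filter fun x => Q x ∧ Function.Injective x) ∪
      (Finset.univ : Finset (Fin L × Fin L)).biUnion fun p =>
        if p.1 = p.2 then ∅ else Finset.univ.filter fun x : Fin L → V => x p.1 = x p.2 := by
    intro x hx
    simp only [Finset.mem_filter, Finset.mem_univ, true_and] at hx
    by_cases hi : Function.Injective x
    · simp [hx, hi]
    · rw [Function.Injective] at hi
      push Not at hi
      obtain ⟨i, j, hij, hne⟩ := hi
      refine Finset.mem_union_right _ (Finset.mem_biUnion.2 ⟨(i, j), by simp, ?_⟩)
      simp [hne, hij]
  refine (Finset.card_le_card hsub).trans ((Finset.card_union_le _ _).trans ?_)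
  gcongr
  refine (Finset.card_biUnion_le_card_mul _ _ (Fintype.card V ^ (L - 1)) ?_).trans ?_
  · rintro ⟨i, j⟩ _
    split_ifs with h
    · simp
    · simp only at h ⊢
      have : (Finset.univ.filter fun x : Fin L → V => x i = x j).card ≤
          (Finset.univ : Finset ({k : Fin L // k ≠ i} → V)).card := by
        refine Finset.card_le_card_of_injOn (fun x k => x k) (by simp) ?_
        intro x hx y hy hxy
        simp only [Finset.coe_filter, Finset.mem_univ, true_and, Set.mem_ofPred_eq] at hx hy
        funext k
        by_cases hk : k = i
        · subst hk
          rw [hx, hy]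
          exact congrFun hxy ⟨j, Ne.symm h⟩
        · exact congrFun hxy ⟨k, hk⟩
      refine this.trans (le_of_eq ?_)
      simp [Finset.card_univ, Fintype.card_subtype_compl]
  · simp [Finset.card_univ, sq]

/-! ### Scaffolds between two cliques -/

/-- `g` is an ordered clique in `W` that can follow `base` as the next block of an `r`-path. -/
def IsNextBlock {V : Type*} (G : SimpleGraph V) (W : Finset V) {r : ℕ} (base g : Fin r → V) :
    Prop :=
  ∀ i, g i ∈ W ∧ (∀ j < i, G.Adj (g j) (g i)) ∧ ∀ j, i ≤ j → G.Adj (base j) (g i)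

-- Entry `i` must be adjacent to `i` earlier entries and to `r - i` entries of the base: exactly `r`
-- vertices, as `hW` allows.
open scoped Classical in
theorem pow_le_card_isNextBlock {V : Type*} [Fintype V] [Nonempty V] (G : SimpleGraph V)
    (W : Finset V) {r c : ℕ}
    (hW : ∀ w : Fin r → V, c ≤ (W.filter fun v => ∀ j, G.Adj (w j) v).card) (base : Fin r → V) :
    c ^ r ≤ (Finset.univ.filter fun g : Fin r → V => IsNextBlock G W base g).card := by
  refine (pow_le_card_of_forall_extension c r (fun i g => g i ∈ W ∧ (∀ j < i, G.Adj (g j) (g i)) ∧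
    ∀ j, i ≤ j → G.Adj (base j) (g i)) ?_ ?_).trans
    (Finset.card_le_card fun g hg => ?_)
  · intro m h h' hh hP
    rw [← hh m le_rfl]
    refine ⟨hP.1, fun j hj => ?_, hP.2.2⟩
    rw [← hh j hj.le]
    exact hP.2.1 j hj
  · intro m h
    refine (hW fun j => if j < m then h j else base j).trans (Finset.card_le_card ?_)
    intro v hv
    simp only [Finset.mem_filter, Finset.mem_univ, true_and, Function.update_self] at hv ⊢
    refine ⟨hv.1, fun j hj => ?_, fun j hj => ?_⟩
    · have := hv.2 j
      rw [if_pos hj] at this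
      rwa [Function.update_of_ne hj.ne]
    · have := hv.2 j
      rwa [if_neg (not_lt.2 hj)] at this
  · exact Finset.mem_filter.2 ⟨Finset.mem_univ _, ((@Finset.mem_filter _ _ (_) _ _).1 hg).2⟩

/-- The vertices that precede row `s` of a half-scaffold which starts at the clique `κ`, runs
through the rows `x 0, x 1, …` and ends in the clique `y`. -/
def halfBase {V : Type*} {r : ℕ} (κ y : Fin r → V) (x : ℕ → Fin r → V) : ℕ → Fin r → V
  | 0 => κ
  | s + 1 => fun j => if hj : (j : ℕ) + 1 < r - s then x s ⟨j + 1, by omega⟩ else y j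

/-- The block at distance `t` from the end of a half-scaffold. -/
def halfBlock {V : Type*} {r : ℕ} (y : Fin r → V) (x : ℕ → Fin r → V) (t : ℕ) (i : Fin r) : V :=
  if (i : ℕ) < r - t then x t i else y i

section Half
variable {V : Type*} {G : SimpleGraph V} {W : Finset V} {r : ℕ} {κ y : Fin r → V}
  {x : ℕ → Fin r → V}

theorem halfBlock_mem (hx : ∀ s < r, IsNextBlock G W (halfBase κ y x s) (x s))
    (hyW : ∀ i, y i ∈ W) (t : ℕ) (i : Fin r) : halfBlock y x t i ∈ W := by
  unfold halfBlock
  split_ifs with h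
  · exact (hx t (by omega) i).1
  · exact hyW i

theorem halfBlock_adj (hx : ∀ s < r, IsNextBlock G W (halfBase κ y x s) (x s))
    (hy : ∀ i j, i ≠ j → G.Adj (y i) (y j)) (t : ℕ) {i j : Fin r} (hij : i < j) :
    G.Adj (halfBlock y x t i) (halfBlock y x t j) := by
  unfold halfBlock
  have hij' : (i : ℕ) < j := hij
  split_ifs with h1 h2 h2
  · exact (hx t (by omega) j).2.1 i hij
  · cases t with
    | zero => omega
    | succ t =>
      have := (hx (t + 1) (by omega) i).2.2 j hij.le
      simp only [halfBase] at this
      rw [dif_neg (by omega)] at this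
      exact this.symm
  · omega
  · exact hy _ _ hij.ne

/-- This is the purpose of the index shift in `halfBase`. Entry `j` of the next block need not see
entry `j` of the present one, so base slot `j` holds entry `j + 1`. The slot thereby freed holds a
further vertex of `y`, and the total stays at `r` constraints. -/
theorem halfBlock_adj_succ (hx : ∀ s < r, IsNextBlock G W (halfBase κ y x s) (x s))
    (hy : ∀ i j, i ≠ j → G.Adj (y i) (y j)) (t : ℕ) {i j : Fin r} (hij : j < i) :
    G.Adj (halfBlock y x t i) (halfBlock y x (t + 1) j) := by
  unfold halfBlock
  have hij' : (j : ℕ) < i := hij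
  split_ifs with h1 h2 h2
  · have := (hx (t + 1) (by omega) j).2.2 ⟨i - 1, by omega⟩ (by rw [Fin.le_def]; simp; omega)
    simp only [halfBase] at this
    rw [dif_pos (by omega)] at this
    convert this using 3
    omega
  · omega
  · have := (hx (t + 1) (by omega) j).2.2 i hij.le
    simp only [halfBase] at this
    rwa [dif_neg (by omega)] at this
  · exact hy _ _ hij.ne'

theorem adj_halfBlock_zero (hx : ∀ s < r, IsNextBlock G W (halfBase κ y x s) (x s))
    {i j : Fin r} (hij : i ≤ j) : G.Adj (κ j) (halfBlock y x 0 i) := by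
  unfold halfBlock
  rw [if_pos (by omega)]
  exact (hx 0 (by omega) i).2.2 j hij

theorem halfBlock_eq_of_le {t : ℕ} (ht : r ≤ t + 1) {i : Fin r} (hi : 0 < (i : ℕ)) :
    halfBlock y x t i = y i := by
  unfold halfBlock
  rw [if_neg (by omega)]

end Half

/-- The vertices that precede row `q` of a scaffold between the cliques `a` and `b`. -/
def scaffoldBase {V : Type*} {r : ℕ} (a b : Fin r → V) (h : ℕ → Fin r → V) (q : ℕ) : Fin r → V :=
  if q = 0 then a
  else if q ≤ r then halfBase a (h 0) (fun s => h (1 + s)) (q - 1)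
  else halfBase (b ∘ Fin.rev) (h 0 ∘ Fin.rev) (fun s => h (1 + r + s)) (q - 1 - r)

theorem halfBase_congr {V : Type*} {r : ℕ} {κ y y' : Fin r → V} {x x' : ℕ → Fin r → V} {s : ℕ}
    (hy : 0 < s → y = y') (hx : ∀ s' < s, x s' = x' s') :
    halfBase κ y x s = halfBase κ y' x' s := by
  cases s with
  | zero => rfl
  | succ s =>
    funext j
    simp only [halfBase]
    rw [hy (by omega), hx s (by omega)]

theorem scaffoldBase_congr {V : Type*} {r : ℕ} {a b : Fin r → V} {h h' : ℕ → Fin r → V} {q : ℕ}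
    (hh : ∀ q' < q, h q' = h' q') : scaffoldBase a b h q = scaffoldBase a b h' q := by
  unfold scaffoldBase
  split_ifs with h1 h2
  · rfl
  · exact halfBase_congr (fun _ => hh _ (by omega)) fun s hs => hh _ (by omega)
  · refine halfBase_congr (fun _ => ?_) fun s hs => hh _ (by omega)
    rw [hh 0 (by omega)]

/-- Extend a finite sequence of rows by the row `d`. -/
def extendRows {A : Type*} {M : ℕ} (d : A) (h : Fin M → A) (q : ℕ) : A :=
  if hq : q < M then h ⟨q, hq⟩ else d

/-- A scaffold between the cliques `a` and `b`: the row `0` is a clique `y`, the rows `1, …, r`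
lead from `a` to `y`, and the rows `r + 1, …, 2 * r` lead from the reverse of `b` to the reverse
of `y`. -/
def IsScaffold {V : Type*} (G : SimpleGraph V) (W : Finset V) {r : ℕ} (a b : Fin r → V)
    (h : Fin (2 * r + 1) → Fin r → V) : Prop :=
  ∀ m : Fin (2 * r + 1), IsNextBlock G W (scaffoldBase a b (extendRows a h) m) (h m)

-- The base of a row depends only on earlier rows, so the rows can be chosen greedily. The target
-- `y` of both halves is row `0` and therefore comes first.
open scoped Classical in
theorem pow_le_card_isScaffold {V : Type*} [Fintype V] [Nonempty V] (G : SimpleGraph V)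
    (W : Finset V) {r c : ℕ}
    (hW : ∀ w : Fin r → V, c ≤ (W.filter fun v => ∀ j, G.Adj (w j) v).card) (a b : Fin r → V) :
    (c ^ r) ^ (2 * r + 1) ≤
      (Finset.univ.filter fun h : Fin (2 * r + 1) → Fin r → V => IsScaffold G W a b h).card := by
  have key : ∀ (m : Fin (2 * r + 1)) (h h' : Fin (2 * r + 1) → Fin r → V),
      (∀ i < m, h i = h' i) → scaffoldBase a b (extendRows a h) m =
        scaffoldBase a b (extendRows a h') m := by
    intro m h h' hh
    refine scaffoldBase_congr fun q hq => ?_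
    have hq' : q < 2 * r + 1 := hq.trans m.2
    simp only [extendRows, dif_pos hq']
    exact hh _ (by rw [Fin.lt_def]; exact hq)
  refine (pow_le_card_of_forall_extension (c ^ r) (2 * r + 1) (fun m h =>
    IsNextBlock G W (scaffoldBase a b (extendRows a h) m) (h m)) ?_ ?_).trans
    (Finset.card_le_card fun g hg => ?_)
  · intro m h h' hh hP
    rwa [← hh m le_rfl, ← key m h h' fun i hi => hh i hi.le]
  · intro m h
    refine (pow_le_card_isNextBlock G W hW (scaffoldBase a b (extendRows a h) m)).trans
      (Finset.card_le_card ?_)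
    intro v hv
    simp only [Finset.mem_filter, Finset.mem_univ, true_and, Function.update_self] at hv ⊢
    rwa [key m _ h fun i hi => Function.update_of_ne hi.ne _ _]
  · exact Finset.mem_filter.2 ⟨Finset.mem_univ _, ((@Finset.mem_filter _ _ (_) _ _).1 hg).2⟩

/-! ### The walk through a scaffold -/

/-- The label (row and column of the scaffold) of the `i`-th vertex of the block `t` of the walk
with `N` blocks. -/
def blockLabel (r N t : ℕ) (i : Fin r) : Fin (2 * r + 1) × Fin r :=
  if t < r then
    if hi : (i : ℕ) < r - t then (⟨1 + t, by omega⟩, i) else (0, i)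
  else
    if hi : (i.rev : ℕ) < r - (N - 1 - t) then (⟨1 + r + (N - 1 - t), by omega⟩, i.rev)
    else (0, i)

/-- The label of the `m`-th vertex of the walk. -/
def walkLabel {r N : ℕ} (m : Fin (r * N)) : Fin (2 * r + 1) × Fin r :=
  blockLabel r N (m / r) ⟨m % r, Nat.mod_lt _ (Nat.pos_of_ne_zero fun h => by
    have := m.2
    simp [h] at this)⟩

section Walk
variable {V : Type*} {G : SimpleGraph V} {W : Finset V} {r N : ℕ} {a b : Fin r → V}
  {h : Fin (2 * r + 1) → Fin r → V}

theorem IsScaffold.left (hh : IsScaffold G W a b h) :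
    ∀ s < r, IsNextBlock G W (halfBase a (h 0) (fun s => extendRows a h (1 + s)) s)
      (extendRows a h (1 + s)) := by
  intro s hs
  have := hh ⟨1 + s, by omega⟩
  simp only [scaffoldBase] at this
  rw [if_neg (by omega), if_pos (by omega)] at this
  have e : extendRows a h (1 + s) = h ⟨1 + s, by omega⟩ := dif_pos (by omega)
  have e0 : extendRows a h 0 = h 0 := dif_pos (by omega)
  rw [e0] at this
  rw [e]
  convert this using 2
  omega

theorem IsScaffold.right (hh : IsScaffold G W a b h) :
    ∀ s < r, IsNextBlock G W (halfBase (b ∘ Fin.rev) (h 0 ∘ Fin.rev)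
      (fun s => extendRows a h (1 + r + s)) s) (extendRows a h (1 + r + s)) := by
  intro s hs
  have := hh ⟨1 + r + s, by omega⟩
  simp only [scaffoldBase] at this
  rw [if_neg (by omega), if_neg (by omega)] at this
  have e : extendRows a h (1 + r + s) = h ⟨1 + r + s, by omega⟩ := dif_pos (by omega)
  have e0 : extendRows a h 0 = h 0 := dif_pos (by omega)
  rw [e0] at this
  rw [e]
  convert this using 2
  omega

theorem IsScaffold.zero_adj (hh : IsScaffold G W a b h) (i j : Fin r) (hij : i ≠ j) :
    G.Adj (h 0 i) (h 0 j) := by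
  rcases lt_or_gt_of_ne hij with h1 | h1
  · exact (hh 0 j).2.1 i h1
  · exact ((hh 0 i).2.1 j h1).symm

theorem apply_blockLabel_of_lt {t : ℕ} (ht : t < r) (i : Fin r) :
    h (blockLabel r N t i).1 (blockLabel r N t i).2 =
      halfBlock (h 0) (fun s => extendRows a h (1 + s)) t i := by
  unfold blockLabel halfBlock
  rw [if_pos ht]
  split_ifs with h1
  · simp only [extendRows]
    rw [dif_pos (show 1 + t < 2 * r + 1 by omega)]
  · rfl

theorem apply_blockLabel_of_le {t : ℕ} (ht : r ≤ t) (i : Fin r) :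
    h (blockLabel r N t i).1 (blockLabel r N t i).2 =
      halfBlock (h 0 ∘ Fin.rev) (fun s => extendRows a h (1 + r + s)) (N - 1 - t) i.rev := by
  unfold blockLabel halfBlock
  rw [if_neg (not_lt.2 ht)]
  split_ifs with h1
  · simp only [extendRows]
    rw [dif_pos (show 1 + r + (N - 1 - t) < 2 * r + 1 by omega)]
  · simp

theorem IsScaffold.blockLabel_mem (hh : IsScaffold G W a b h) (t : ℕ) (i : Fin r) :
    h (blockLabel r N t i).1 (blockLabel r N t i).2 ∈ W := by
  rcases lt_or_ge t r with ht | ht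
  · rw [apply_blockLabel_of_lt (h := h) (a := a) ht]
    exact halfBlock_mem hh.left (fun i => (hh 0 i).1) _ _
  · rw [apply_blockLabel_of_le (h := h) (a := a) ht]
    exact halfBlock_mem hh.right (fun i => (hh 0 _).1) _ _

theorem IsScaffold.zero_rev_adj (hh : IsScaffold G W a b h) (i j : Fin r) (hij : i ≠ j) :
    G.Adj ((h 0 ∘ Fin.rev) i) ((h 0 ∘ Fin.rev) j) :=
  hh.zero_adj _ _ fun he => hij (Fin.rev_injective he)

theorem IsScaffold.blockLabel_adj (hh : IsScaffold G W a b h) (t : ℕ) {i j : Fin r} (hij : i < j) :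
    G.Adj (h (blockLabel r N t i).1 (blockLabel r N t i).2)
      (h (blockLabel r N t j).1 (blockLabel r N t j).2) := by
  rcases lt_or_ge t r with ht | ht
  · rw [apply_blockLabel_of_lt (h := h) (a := a) ht, apply_blockLabel_of_lt (h := h) (a := a) ht]
    exact halfBlock_adj hh.left hh.zero_adj _ hij
  · rw [apply_blockLabel_of_le (h := h) (a := a) ht, apply_blockLabel_of_le (h := h) (a := a) ht]
    exact (halfBlock_adj hh.right hh.zero_rev_adj _ (Fin.rev_lt_rev.2 hij)).symm

/-- Within the left part this is the half-scaffold property, and within the right part the same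
property read backwards. At the junction of blocks `r - 1` and `r`, the bound `2 * r ≤ N` ensures
that both relevant entries already belong to the clique `y`. -/
theorem IsScaffold.blockLabel_adj_succ (hh : IsScaffold G W a b h) (hN : 2 * r ≤ N) {t : ℕ}
    (htN : t + 1 < N) {i j : Fin r} (hij : j < i) :
    G.Adj (h (blockLabel r N t i).1 (blockLabel r N t i).2)
      (h (blockLabel r N (t + 1) j).1 (blockLabel r N (t + 1) j).2) := by
  have hij' : (j : ℕ) < i := hij
  rcases lt_or_ge (t + 1) r with ht | ht
  · rw [apply_blockLabel_of_lt (h := h) (a := a) ht, apply_blockLabel_of_lt (h := h) (a := a) (by omega)]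
    exact halfBlock_adj_succ hh.left hh.zero_adj _ hij
  rw [apply_blockLabel_of_le (h := h) (a := a) ht]
  rcases lt_or_ge t r with ht' | ht'
  · rw [apply_blockLabel_of_lt (h := h) (a := a) ht', halfBlock_eq_of_le ht (by omega),
      halfBlock_eq_of_le (by omega) (by rw [Fin.val_rev]; omega)]
    simpa using hh.zero_adj _ _ hij.ne'
  · rw [apply_blockLabel_of_le (h := h) (a := a) ht']
    have := halfBlock_adj_succ hh.right hh.zero_rev_adj (N - 1 - (t + 1)) (Fin.rev_lt_rev.2 hij)
    rw [show N - 1 - (t + 1) + 1 = N - 1 - t by omega] at this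
    exact this.symm

theorem IsScaffold.walk_mem (hh : IsScaffold G W a b h) (m : Fin (r * N)) :
    h (walkLabel m).1 (walkLabel m).2 ∈ W := hh.blockLabel_mem _ _

theorem IsScaffold.walk_adj (hh : IsScaffold G W a b h) (hN : 2 * r ≤ N) {m m' : Fin (r * N)}
    (hlt : m < m') (hr : (m' : ℕ) < m + r) :
    G.Adj (h (walkLabel m).1 (walkLabel m).2) (h (walkLabel m').1 (walkLabel m').2) := by
  have hlt' : (m : ℕ) < m' := hlt
  have hr0 : 0 < r := by omega
  unfold walkLabel
  have h1 := Nat.div_add_mod (m : ℕ) r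
  have h2 := Nat.div_add_mod (m' : ℕ) r
  have h3 : (m : ℕ) / r ≤ (m' : ℕ) / r := Nat.div_le_div_right hlt'.le
  have h4 : (m' : ℕ) / r ≤ (m : ℕ) / r + 1 := by
    rw [← Nat.add_div_right _ hr0]
    exact Nat.div_le_div_right hr.le
  have h5 : (m' : ℕ) / r < N := Nat.div_lt_of_lt_mul m'.2
  rcases Nat.eq_or_lt_of_le h3 with h6 | h6
  · rw [← h6] at h2 ⊢
    exact hh.blockLabel_adj _ (by rw [Fin.lt_def]; simp only; omega)
  · have h7 : (m' : ℕ) / r = (m : ℕ) / r + 1 := by omega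
    rw [h7] at h2 h5 ⊢
    rw [mul_add] at h2
    exact hh.blockLabel_adj_succ hN h5 (by rw [Fin.lt_def]; simp only; omega)

theorem IsScaffold.adj_walk (hh : IsScaffold G W a b h) {m : Fin (r * N)} {j : Fin r}
    (hj : (m : ℕ) ≤ j) : G.Adj (a j) (h (walkLabel m).1 (walkLabel m).2) := by
  unfold walkLabel
  have h1 : (m : ℕ) / r = 0 := Nat.div_eq_of_lt (by omega)
  have h2 : (m : ℕ) % r = m := Nat.mod_eq_of_lt (by omega)
  simp only [h1, h2]
  rw [apply_blockLabel_of_lt (h := h) (a := a) (by omega)]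
  exact adj_halfBlock_zero hh.left (by rw [Fin.le_def]; exact hj)

theorem IsScaffold.walk_adj_end (hh : IsScaffold G W a b h) (hN : 2 * r ≤ N) {m : Fin (r * N)}
    {j : Fin r} (hj : r * N + j ≤ m + r) : G.Adj (h (walkLabel m).1 (walkLabel m).2) (b j) := by
  have hr0 : 0 < r := by omega
  unfold walkLabel
  obtain ⟨N, rfl⟩ : ∃ N', N = N' + 1 := ⟨N - 1, by omega⟩
  have hm := m.2
  have hj' : r * N + r + j ≤ (m : ℕ) + r := hj
  have hm' : (m : ℕ) < r * N + r := hm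
  have h1 : (m : ℕ) / r = N := by
    rw [Nat.div_eq_iff hr0]
    rw [mul_comm r N] at hj' hm'
    omega
  have h2 := Nat.div_add_mod (m : ℕ) r
  rw [h1] at h2
  simp only [h1]
  rw [apply_blockLabel_of_le (h := h) (a := a) (by omega)]
  simp only [Nat.add_sub_cancel, Nat.sub_self]
  have := adj_halfBlock_zero hh.right (i := Fin.rev ⟨(m : ℕ) % r, Nat.mod_lt _ hr0⟩) (j := j.rev)
    (by rw [Fin.rev_le_rev, Fin.le_def]; simp only; omega)
  simpa using this.symm

end Walk

/-! ### Sparse walks and their completion to power paths -/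

/-- The sequence `x` in `W` continues the clique `a` and is continued by the clique `b` in the way
an `r`-path of `G` does, except that entries at distance exactly `r` need not be adjacent. -/
structure IsSparseWalk {V : Type*} (G : SimpleGraph V) (W : Finset V) {r L : ℕ} (a b : Fin r → V)
    (x : Fin L → V) : Prop where
  injective : Function.Injective x
  mem : ∀ m, x m ∈ W
  adj : ∀ m m' : Fin L, m < m' → (m' : ℕ) < m + r → G.Adj (x m) (x m')
  left_adj : ∀ (m : Fin L) (j : Fin r), (m : ℕ) ≤ j → G.Adj (a j) (x m)
  adj_right : ∀ (m : Fin L) (j : Fin r), L + j ≤ (m : ℕ) + r → G.Adj (x m) (b j)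

open scoped Classical in
/-- If any `r` vertices have linearly many common neighbours in `W`, then there is a positive
proportion of sparse walks between any two ordered `r`-cliques. -/
theorem exists_dense_isSparseWalk (r N : ℕ) (hr : 0 < r) (hN : 2 * r ≤ N) (c₀ : ℝ) (hc₀ : 0 < c₀) :
    ∃ β : ℝ, 0 < β ∧ ∃ n₀ : ℕ, ∀ (V : Type) [Fintype V] [Nonempty V], n₀ ≤ Fintype.card V →
      ∀ (G : SimpleGraph V) (W : Finset V),
        (∀ w : Fin r → V, c₀ * Fintype.card V ≤
          ((W.filter fun v => ∀ j, G.Adj (w j) v).card : ℝ)) →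
        ∀ a b : Fin r → V, β * (Fintype.card V : ℝ) ^ (r * N) ≤
          ((Finset.univ.filter fun x : Fin (r * N) → V => IsSparseWalk G W a b x).card : ℝ) := by
  set M := 2 * r + 1 with hM
  obtain ⟨β, hβ, H⟩ := exists_dense_isPullback (Fin M × Fin r) (r * N) ((c₀ ^ r) ^ M)
    (by positivity)
  -- Beyond this threshold the non-injective sequences, at most `(r * N) ^ 2 * n ^ (r * N - 1)` in
  -- number, cost at most half of the density `β`.
  refine ⟨β / 2, by positivity, ⌈2 * ((r * N : ℕ) : ℝ) ^ 2 / β⌉₊,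
    fun V _ _ hn G W hW a b => ?_⟩
  set n := Fintype.card V with hnV
  set c := ⌈c₀ * n⌉₊ with hc
  have hW' : ∀ w : Fin r → V, c ≤ (W.filter fun v => ∀ j, G.Adj (w j) v).card := fun w =>
    Nat.ceil_le.2 (hW w)
  have h1 := pow_le_card_isScaffold G W hW' a b
  let S : Finset (Fin M → Fin r → V) := Finset.univ.filter fun h => IsScaffold G W a b h
  let T : Finset (Fin M × Fin r → V) := S.image fun h p => h p.1 p.2
  have hT : T.card = S.card := Finset.card_image_of_injective _ fun h h' he => by
    funext i j
    exact congrFun he (i, j)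
  have h2 : (c₀ ^ r) ^ M * (n : ℝ) ^ (Fintype.card (Fin M × Fin r)) ≤ (T.card : ℝ) := by
    have h3 : ((c ^ r) ^ M : ℝ) ≤ (T.card : ℝ) := by
      rw [hT]
      exact_mod_cast h1
    refine le_trans ?_ h3
    have : c₀ * n ≤ c := Nat.le_ceil _
    calc (c₀ ^ r) ^ M * (n : ℝ) ^ (Fintype.card (Fin M × Fin r)) = ((c₀ * n) ^ r) ^ M := by
          simp only [Fintype.card_prod, Fintype.card_fin, mul_pow, ← pow_mul]
          rw [mul_comm M r]
      _ ≤ _ := by gcongr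
  have h3 := H V T walkLabel h2
  have h4 := card_sub_le_card_injective (V := V) (r * N) (IsPullback T walkLabel)
  have h5 : (Finset.univ.filter fun x : Fin (r * N) → V =>
      IsPullback T walkLabel x ∧ Function.Injective x) ⊆
      Finset.univ.filter fun x : Fin (r * N) → V => IsSparseWalk G W a b x := by
    intro x hx
    simp only [Finset.mem_filter, Finset.mem_univ, true_and] at hx ⊢
    obtain ⟨⟨hx2, hx1⟩, hinj⟩ := hx
    have hS : ∀ g ∈ T, ∃ h, IsScaffold G W a b h ∧ g = fun p => h p.1 p.2 := by
      intro g hg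
      obtain ⟨h, hh, rfl⟩ := Finset.mem_image.1 hg
      exact ⟨h, (Finset.mem_filter.1 hh).2, rfl⟩
    -- Adjacency inside the walk is an irreflexive binary relation; membership in `W` and adjacency
    -- to a fixed vertex of `a` or `b` are unary. All of them pass from scaffolds to pullbacks.
    refine ⟨hinj, fun m => hx1 m (fun v => v ∈ W) ?_, fun m m' hm hm' =>
      hx2 m m' G.Adj (fun v => G.irrefl) ?_, fun m j hj => hx1 m (fun v => G.Adj (a j) v) ?_,
      fun m j hj => hx1 m (fun v => G.Adj v (b j)) ?_⟩
    all_goals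
      intro g hg
      obtain ⟨h, hh, rfl⟩ := hS g hg
    · exact hh.walk_mem m
    · exact hh.walk_adj hN hm hm'
    · exact hh.adj_walk hj
    · exact hh.walk_adj_end hN hj
  have h6 : β * (n : ℝ) ^ (r * N) ≤ ((Finset.univ.filter fun x : Fin (r * N) → V =>
      IsSparseWalk G W a b x).card : ℝ) + ((r * N : ℕ) : ℝ) ^ 2 * (n : ℝ) ^ (r * N - 1) := by
    refine h3.trans ?_
    have := h4.trans (Nat.add_le_add_right (Finset.card_le_card h5) _)
    exact_mod_cast this
  have hL : 0 < r * N := Nat.mul_pos hr (by omega)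
  have h7 : ((r * N : ℕ) : ℝ) ^ 2 * (n : ℝ) ^ (r * N - 1) ≤ β / 2 * (n : ℝ) ^ (r * N) := by
    have e : (n : ℝ) ^ (r * N) = n * (n : ℝ) ^ (r * N - 1) := by
      rw [← pow_succ', Nat.sub_add_cancel hL]
    rw [e, ← mul_assoc]
    gcongr
    have := (Nat.le_ceil _).trans (Nat.cast_le (α := ℝ).2 hn)
    rw [div_le_iff₀ hβ] at this
    linarith
  linarith

/-- `Γ` is needed only for two internal vertices at distance exactly `r`. All adjacencies involving
`a` or `b` come from `G`, and since `r ≤ L` no vertex of `a` is within distance `r` of one of `b`.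
-/
theorem IsSparseWalk.isConnectedThrough {V : Type*} {G Γ : SimpleGraph V} {W : Finset V} {r L : ℕ}
    {a b : Fin r → V} {x : Fin L → V} (hx : IsSparseWalk G W a b x)
    (hΓ : ∀ m m' : Fin L, (m' : ℕ) = m + r → Γ.Adj (x m) (x m'))
    (ha : IsOrderedClique G a) (hb : IsOrderedClique G b) (haW : ∀ i, a i ∉ W)
    (hbW : ∀ i, b i ∉ W) (hab : ∀ i j, a i ≠ b j) (hL : r ≤ L) :
    IsConnectedThrough (G ⊔ Γ) r L W a b := by
  have inj : ∀ {c : Fin r → V}, IsOrderedClique G c → Function.Injective c := by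
    intro c hc i j hij
    by_contra hne
    have := hc i j hne
    rw [hij] at this
    exact G.irrefl this
  refine ⟨x, hx.mem, ?_, ?_⟩
  · rw [Fin.append_injective_iff, Fin.append_injective_iff]
    refine ⟨⟨inj ha, hx.injective, fun i j h => haW i (h ▸ hx.mem j)⟩, inj hb, ?_⟩
    intro i j
    induction i using Fin.addCases with
    | left i => simpa using hab i j
    | right i =>
      simp only [Fin.append_right]
      exact fun h => hbW j (h ▸ hx.mem i)
  · intro i j hij hd
    rw [Fin.lt_def] at hij
    induction i using Fin.addCases with
    | left i =>
      induction i using Fin.addCases with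
      | left i =>
        induction j using Fin.addCases with
        | left j =>
          induction j using Fin.addCases with
          | left j =>
            simp only [Fin.append_left]
            exact Or.inl (ha i j (by rintro rfl; simp at hij))
          | right j =>
            simp only [Fin.append_left, Fin.append_right, Fin.val_castAdd, Fin.val_natAdd] at hd ⊢
            exact Or.inl (hx.left_adj j i (by omega))
        | right j =>
          simp only [Fin.val_castAdd, Fin.val_natAdd] at hd
          omega
      | right i =>
        induction j using Fin.addCases with
        | left j =>
          induction j using Fin.addCases with
          | left j =>
            simp only [Fin.val_castAdd, Fin.val_natAdd] at hij
            omega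
          | right j =>
            simp only [Fin.append_left, Fin.append_right, Fin.val_castAdd,
              Fin.val_natAdd] at hd hij ⊢
            rcases Nat.lt_or_ge (j : ℕ) (i + r) with h | h
            · exact Or.inl (hx.adj i j (by rw [Fin.lt_def]; omega) h)
            · exact Or.inr (hΓ i j (by omega))
        | right j =>
          simp only [Fin.append_left, Fin.append_right, Fin.val_castAdd, Fin.val_natAdd] at hd ⊢
          exact Or.inl (hx.adj_right i j (by omega))
    | right i =>
      induction j using Fin.addCases with
      | left j =>
        simp only [Fin.val_castAdd, Fin.val_natAdd] at hij
        omega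
      | right j =>
        simp only [Fin.append_right]
        exact Or.inl (hb i j (by rintro rfl; simp at hij))

/-- The walk has `2 ^ r` blocks, and the two halves of a scaffold need `r` blocks each. -/
theorem two_mul_le_two_pow {r : ℕ} (hr : 0 < r) : 2 * r ≤ 2 ^ r := by
  induction r with
  | zero => omega
  | succ r ih =>
    rcases Nat.eq_zero_or_pos r with rfl | h
    · norm_num
    · have := ih h
      have : 1 ≤ r := h
      rw [pow_succ]
      omega

/-! ### Two-round exposure and missing edges in the binomial random graph -/

open MeasureTheory ProbabilityTheory unitInterval in
/-- The union of two independent random sets with densities `q` is a random set of density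
`1 - (1 - q) ^ 2`. -/
theorem setBernoulli_eq_map_union {ι : Type*} [Fintype ι] (u : Set ι) {p q : I}
    (h : (1 - p : ℝ) = (1 - q) ^ 2) :
    setBernoulli u p = ((setBernoulli u q).prod (setBernoulli u q)).map fun x => x.1 ∪ x.2 := by
  let μ : I → ι → Measure Prop := fun p i =>
    toNNReal p • Measure.dirac (i ∈ u) + toNNReal (σ p) • Measure.dirac False
  have hμ : ∀ p i, IsProbabilityMeasure (μ p i) := fun p i => inferInstance
  have hm : Measurable fun x : Prop × Prop => x.1 ∨ x.2 := Measurable.of_discrete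
  have hcoord : ∀ i, μ p i = ((μ q i).prod (μ q i)).map fun x => x.1 ∨ x.2 := by
    intro i
    have h1 : toNNReal (σ p) = toNNReal (σ q) * toNNReal (σ q) := by
      ext
      simp only [coe_toNNReal, NNReal.coe_mul, coe_symm_eq]
      rw [h, sq]
    have h2 : toNNReal p = toNNReal q * toNNReal q + toNNReal (σ q) * toNNReal q
        + toNNReal q * toNNReal (σ q) := by
      ext
      simp only [coe_toNNReal, NNReal.coe_mul, NNReal.coe_add, coe_symm_eq]
      linear_combination -h
    simp only [μ]
    rw [Measure.prod_add, Measure.add_prod, Measure.add_prod, Measure.map_add _ _ hm,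
      Measure.map_add _ _ hm, Measure.map_add _ _ hm]
    simp only [Measure.prod_smul_left, Measure.prod_smul_right, Measure.dirac_prod_dirac,
      Measure.map_smul, Measure.map_dirac' hm, or_self, or_false, false_or, smul_smul, h1, h2]
    simp only [add_smul]
    abel
  have hpi : ∀ p, setBernoulli u p =
      (Measure.pi (μ p)).map fun f : ι → Prop => {i | f i} := fun p => by
    rw [setBernoulli_eq_map, Measure.infinitePi_eq_pi]
  have hs : Measurable fun f : ι → Prop => {i | f i} :=
    MeasurableEquiv.setOfPred.measurable
  rw [hpi p, hpi q, Measure.map_prod_map _ _ hs hs, Measure.map_map (by fun_prop) (by fun_prop)]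
  rw [← (measurePreserving_arrowProdEquivProdArrow Prop Prop ι (μ q) (μ q)).map_eq,
    Measure.map_map (by fun_prop) (by fun_prop)]
  have : (Measure.pi (μ p)) =
      (Measure.pi fun i => (μ q i).prod (μ q i)).map fun x i => (x i).1 ∨ (x i).2 := by
    have : ∀ i, SigmaFinite (((μ q i).prod (μ q i)).map fun x : Prop × Prop => x.1 ∨ x.2) := by
      intro i
      rw [← hcoord]
      infer_instance
    rw [Measure.pi_map_pi (f := fun i (x : Prop × Prop) => x.1 ∨ x.2) fun i => hm.aemeasurable]
    congr 1
    funext i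
    exact hcoord i
  rw [this, Measure.map_map hs (by fun_prop)]
  congr 1

open MeasureTheory in
instance {V : Type*} [Fintype V] : MeasurableSingletonClass (SimpleGraph V) := by
  refine ⟨fun Γ => ?_⟩
  have : ({Γ} : Set (SimpleGraph V)) = SimpleGraph.edgeSet ⁻¹' {Γ.edgeSet} := by
    ext Γ'
    simp
  rw [this]
  exact SimpleGraph.measurable_edgeSet (Set.toFinite _).measurableSet

open MeasureTheory ProbabilityTheory unitInterval in
theorem binomialRandom_eq_map_sup {V : Type*} [Fintype V] {p q : I}
    (h : (1 - p : ℝ) = (1 - q) ^ 2) :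
    SimpleGraph.binomialRandom V p =
      ((SimpleGraph.binomialRandom V q).prod (SimpleGraph.binomialRandom V q)).map
        fun x => x.1 ⊔ x.2 := by
  rw [SimpleGraph.binomialRandom_eq_map, SimpleGraph.binomialRandom_eq_map,
    setBernoulli_eq_map_union _ h, Measure.map_prod_map _ _ (by fun_prop) (by fun_prop),
    Measure.map_map (by fun_prop) .of_discrete,
    Measure.map_map .of_discrete (by fun_prop)]
  congr 1
  funext x
  simp [SimpleGraph.fromEdgeSet_union]

-- Distinct pairs are independent. Loops are excluded because a loop is never an edge and would
-- contribute a factor `1`.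
open MeasureTheory ProbabilityTheory unitInterval in
theorem binomialRandom_real_disjoint {V : Type*} [Fintype V] (p : I) (D : Finset (Sym2 V))
    (hD : ∀ e ∈ D, ¬ e.IsDiag) :
    (SimpleGraph.binomialRandom V p).real {Γ | ∀ e ∈ D, e ∉ Γ.edgeSet} =
      (1 - p : ℝ) ^ D.card := by
  classical
  have hs : Measurable fun f : Sym2 V → Prop => {i | f i} :=
    MeasurableEquiv.setOfPred.measurable
  rw [SimpleGraph.binomialRandom_eq_map, setBernoulli_eq_map,
    Measure.map_map (by fun_prop) hs, measureReal_def,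
    Measure.map_apply (SimpleGraph.measurable_fromEdgeSet.comp hs) (Set.toFinite _).measurableSet]
  have : (SimpleGraph.fromEdgeSet ∘ fun f : Sym2 V → Prop => {i | f i}) ⁻¹'
      {Γ : SimpleGraph V | ∀ e ∈ D, e ∉ Γ.edgeSet} =
      Set.pi (D : Set (Sym2 V)) fun _ => {False} := by
    ext f
    simp only [Set.mem_preimage, Set.mem_ofPred_eq, Function.comp, SimpleGraph.edgeSet_fromEdgeSet,
      Set.mem_pi, Set.mem_singleton_iff, Finset.mem_coe]
    refine forall₂_congr fun e he => ?_
    have := hD e he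
    simp [this]
  rw [this, Measure.infinitePi_pi _ (by simp)]
  rw [Finset.prod_congr rfl (g := fun _ => (toNNReal (σ p) : ENNReal))]
  · simp
  · intro e he
    have := hD e he
    simp [this]

/-! ### Linking a dense family by random edges -/

open MeasureTheory in
/-- Markov's inequality: if every point of `E` lies in at least `t` of the sets `F g`, then
`t * μ E` is at most the sum of the measures of the sets `F g`. -/
theorem mul_measureReal_le_sum {Ω κ : Type*} [MeasurableSpace Ω] [DiscreteMeasurableSpace Ω]
    (μ : Measure Ω) [IsFiniteMeasure μ] (I : Finset κ) (E : Set Ω) (F : κ → Set Ω)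
    [∀ ω, DecidablePred fun g => ω ∈ F g] {t : ℝ}
    (h : ∀ ω ∈ E, t ≤ ((I.filter fun g => ω ∈ F g).card : ℝ)) :
    t * μ.real E ≤ ∑ g ∈ I, μ.real (F g) := by
  have h1 : ∀ s : Set Ω, Integrable (s.indicator fun _ => (1 : ℝ)) μ := fun s =>
    (integrable_const (1 : ℝ)).indicator .of_discrete
  have h2 : ∀ s : Set Ω, μ.real s = ∫ ω, s.indicator (fun _ => (1 : ℝ)) ω ∂μ := fun s => by
    rw [integral_indicator .of_discrete]
    simp
  simp only [h2]
  rw [← integral_finsetSum _ fun g _ => h1 _, ← integral_const_mul]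
  refine integral_mono ((h1 E).const_mul t) (integrable_finsetSum _ fun g _ => h1 _) fun ω => ?_
  have h3 : ∑ g ∈ I, (F g).indicator (fun _ => (1 : ℝ)) ω =
      ((I.filter fun g => ω ∈ F g).card : ℝ) := by
    classical
    simp [Set.indicator_apply]
  simp only [h3]
  by_cases hω : ω ∈ E
  · simpa [hω] using h ω hω
  · simp [hω]

open scoped Classical in
/-- For each vertex `v` of `W` let `X v` be a large set of objects attached to `v`, each with many
targets outside `W`. It is very unlikely that, for every `v ∈ W`, many of the objects in `X v` see
no random edge from `v` to their targets. -/
theorem binomialRandom_real_forall_le {V X : Type*} [Fintype V] [Fintype X] (p : unitInterval)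
    (W : Finset V) (R : V → Finset X) (T : X → V → Prop) (N : ℕ) (a d : ℝ) (ha : 0 ≤ a)
    (hR : ∀ v, (R v).card ≤ N)
    (hT : ∀ v ∈ W, ∀ x ∈ R v,
      d ≤ ((Finset.univ.filter fun y : V => T x y ∧ y ∉ W).card : ℝ)) :
    (a * N) ^ W.card * (SimpleGraph.binomialRandom V p).real {Γ | ∀ v ∈ W,
      a * N ≤ (((R v).filter fun x => ∀ y, T x y → ¬ Γ.Adj v y).card : ℝ)} ≤
    (N : ℝ) ^ W.card * Real.exp (-(p * (W.card * d))) := by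
  -- A member of `I` selects one object for every `v ∈ W`, and `F g` is the event that all selected
  -- objects fail. Averaging over selections costs only a factor `a⁻¹` per vertex, whereas a union
  -- bound would cost `N`.
  let I : Finset (W → X) := Fintype.piFinset fun v : W => R v
  let F : (W → X) → Set (SimpleGraph V) := fun g =>
    {Γ | ∀ v : W, ∀ y, T (g v) y → ¬ Γ.Adj v y}
  have hF : ∀ g ∈ I, (SimpleGraph.binomialRandom V p).real (F g) ≤
      Real.exp (-(p * (W.card * d))) := by
    intro g hg
    have hg' : ∀ v : W, g v ∈ R v := by simpa [I, Fintype.mem_piFinset] using hg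
    let P : Finset (Σ _ : W, V) := Finset.univ.sigma fun v : W =>
      Finset.univ.filter fun y : V => T (g v) y ∧ y ∉ W
    let D : Finset (Sym2 V) := P.image fun z => s(z.1.1, z.2)
    -- The pairs `v y` have `v ∈ W` and `y ∉ W`, so no edge is counted twice.
    have hDc : D.card = P.card := by
      refine Finset.card_image_of_injOn ?_
      rintro ⟨v, y⟩ h1 ⟨v', y'⟩ h2 h
      simp only [P, Finset.coe_sigma, Set.mem_sigma_iff, Finset.coe_filter, Finset.mem_univ,
        true_and, Set.mem_ofPred_eq] at h1 h2
      simp only [Sym2.eq_iff] at h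
      rcases h with ⟨h, h'⟩ | ⟨h, h'⟩
      · obtain rfl := Subtype.ext h
        obtain rfl := h'
        rfl
      · exact absurd (h ▸ v.2) h2.2.2
    have hPc : W.card * d ≤ (P.card : ℝ) := by
      simp only [P, Finset.card_sigma, Nat.cast_sum]
      calc (W.card : ℝ) * d = ∑ _v : W, d := by simp
        _ ≤ _ := Finset.sum_le_sum fun v _ => hT v v.2 _ (hg' v)
    have hsub : F g ⊆ {Γ | ∀ e ∈ D, e ∉ Γ.edgeSet} := by
      intro Γ hΓ e he
      obtain ⟨⟨v, y⟩, hz, rfl⟩ := Finset.mem_image.1 he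
      simp only [P, Finset.mem_sigma, Finset.mem_univ, true_and, Finset.mem_filter] at hz
      exact hΓ v y hz.1
    have hdiag : ∀ e ∈ D, ¬ e.IsDiag := by
      intro e he
      obtain ⟨⟨v, y⟩, hz, rfl⟩ := Finset.mem_image.1 he
      simp only [P, Finset.mem_sigma, Finset.mem_univ, true_and, Finset.mem_filter] at hz
      rw [Sym2.mk_isDiag_iff]
      intro h
      have h : (v : V) = y := h
      exact hz.2 (h ▸ v.2)
    refine (MeasureTheory.measureReal_mono hsub).trans ?_
    rw [binomialRandom_real_disjoint p D hdiag, hDc]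
    have hp0 : (0 : ℝ) ≤ p := p.2.1
    have hp1 : (0 : ℝ) ≤ 1 - p := by linarith [p.2.2]
    calc (1 - p : ℝ) ^ P.card ≤ (Real.exp (-p)) ^ P.card := by
          gcongr
          linarith [Real.add_one_le_exp (-(p : ℝ))]
      _ = Real.exp (-(p * P.card)) := by
          rw [← Real.exp_nat_mul]
          congr 1
          ring
      _ ≤ _ := by gcongr
  have hIc : (I.card : ℝ) ≤ (N : ℝ) ^ W.card := by
    simp only [I, Fintype.card_piFinset]
    rw [← Fintype.card_coe W]
    norm_cast
    exact Finset.prod_le_pow_card Finset.univ _ N fun v _ => hR v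
  have hM := mul_measureReal_le_sum (SimpleGraph.binomialRandom V p) I
    {Γ | ∀ v ∈ W, a * N ≤ (((R v).filter fun x => ∀ y, T x y → ¬ Γ.Adj v y).card : ℝ)} F
    (t := (a * N) ^ W.card) (by
      intro Γ hΓ
      have e : (I.filter fun g => Γ ∈ F g) = Fintype.piFinset fun v : W =>
          (R v).filter fun x => ∀ y, T x y → ¬ Γ.Adj v y := by
        ext g
        simp only [I, F, Finset.mem_filter, Fintype.mem_piFinset, Set.mem_ofPred_eq]
        exact ⟨fun h v => ⟨h.1 v, h.2 v⟩, fun h => ⟨fun v => (h v).1, fun v => (h v).2⟩⟩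
      rw [e, Fintype.card_piFinset, Nat.cast_prod, ← Fintype.card_coe W, ← Finset.card_univ,
        ← Finset.prod_const]
      exact Finset.prod_le_prod (fun _ _ => by positivity) fun v _ => hΓ v v.2)
  refine hM.trans ((Finset.sum_le_sum hF).trans ?_)
  rw [Finset.sum_const, nsmul_eq_mul]
  gcongr

open scoped Classical in
/-- Let `T` be a dense relation between `X` and `V`, where `X` is fibred over `V` with fibres of
equal size. A random graph of density `C / n` joins a positive proportion of the `x ∈ X` to a vertex
that is related to `x`, with exponentially small failure probability. -/
theorem exists_binomialRandom_real_card_lt (β A : ℝ) (hβ : 0 < β) (hA : 0 < A) :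
    ∃ C : ℝ, 0 < C ∧ ∃ n₀ : ℕ, ∀ (V X : Type) [Fintype V] [Nonempty V] [Fintype X],
      n₀ ≤ Fintype.card V → ∀ (f : X → V) (N : ℕ),
      (∀ v, (Finset.univ.filter fun x => f x = v).card = N) →
      ∀ T : X → V → Prop, β * Fintype.card X * Fintype.card V ≤
        ((Finset.univ.filter fun z : X × V => T z.1 z.2).card : ℝ) →
      ∀ p : unitInterval, C / Fintype.card V ≤ (p : ℝ) →
        (SimpleGraph.binomialRandom V p).real
          {Γ | ((Finset.univ.filter fun x => ∃ y, T x y ∧ Γ.Adj (f x) y).card : ℝ) <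
            β / 4 * Fintype.card X} ≤ Real.exp (-(A * Fintype.card V)) := by
  -- Chosen so that `β / 4 * C - 8 / β = 16 * (A + 1) / β`. Multiplied by `w ≥ β / 16 * n`, this
  -- gives `(A + 1) * n`, of which one `n` pays for the `2 ^ n` sets `W`. The bound `16 / β` on `n`
  -- absorbs the rounding in `w`.
  set C : ℝ := 4 / β * (8 / β + 16 * (A + 1) / β) with hC
  refine ⟨C, by positivity, ⌈16 / β⌉₊, fun V X _ _ _ hn f N hf T hT p hp => ?_⟩
  set n : ℝ := (Fintype.card V : ℝ) with hnV
  have hn0 : 0 < n := by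
    rw [hnV]
    exact_mod_cast Fintype.card_pos
  have hn16 : 16 ≤ β * n := by
    have := (Nat.le_ceil _).trans (Nat.cast_le (α := ℝ).2 hn)
    rw [div_le_iff₀ hβ] at this
    linarith
  have hX : (Fintype.card X : ℝ) = N * n := by
    have := Finset.card_eq_sum_card_fiberwise (f := f) (s := Finset.univ) (t := Finset.univ)
      (fun _ _ => by simp)
    rw [Finset.card_univ] at this
    rw [this]
    simp [hf, hnV, mul_comm]
  let Bad : Set (SimpleGraph V) :=
    {Γ | ((Finset.univ.filter fun x => ∃ y, T x y ∧ Γ.Adj (f x) y).card : ℝ) <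
            β / 4 * Fintype.card X}
  change (SimpleGraph.binomialRandom V p).real Bad ≤ _
  rcases Nat.eq_zero_or_pos N with hN | hN
  · have : Bad = ∅ := by
      ext Γ
      simp only [Bad, Set.mem_ofPred_eq, Set.mem_empty_iff_false, iff_false, not_lt, hX, hN]
      simp
    rw [this]
    simp only [MeasureTheory.measureReal_empty]
    positivity
  set Rich := Finset.univ.filter fun x : X =>
    β / 2 * n ≤ ((Finset.univ.filter fun y : V => T x y).card : ℝ) with hRich
  have hRichc : β / 2 * Fintype.card X ≤ (Rich.card : ℝ) :=
    half_mul_card_le_card_heavy T hβ.le hT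
  set w := ⌊β / 8 * n⌋₊ with hw
  have hw1 : (w : ℝ) ≤ β / 8 * n := Nat.floor_le (by positivity)
  have hw2 : β / 16 * n ≤ w := by
    have := Nat.lt_floor_add_one (β / 8 * n)
    rw [← hw] at this
    nlinarith
  let R : V → Finset X := fun v => Rich.filter fun x => f x = v
  let Ev : Finset V → Set (SimpleGraph V) := fun W => {Γ | ∀ v ∈ W,
      β / 8 * N ≤ (((R v).filter fun x => ∀ y, T x y → ¬ Γ.Adj v y).card : ℝ)}
  have hN' : (0 : ℝ) < N := by exact_mod_cast hN
  have hEv : ∀ W ∈ Finset.powersetCard w (Finset.univ : Finset V),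
      (SimpleGraph.binomialRandom V p).real (Ev W) ≤
        (8 / β) ^ w * Real.exp (-(p * (w * (β / 4 * n)))) := by
    intro W hW
    have hWc : W.card = w := (Finset.mem_powersetCard.1 hW).2
    -- A rich `x` has `β / 2 * n` targets, at most `β / 8 * n` of them in `W`, so at least `β / 4 *
    -- n` remain.
    have := binomialRandom_real_forall_le p W R T N (β / 8) (β / 4 * n) (by positivity)
      (fun v => by
        rw [← hf v]
        exact Finset.card_le_card (Finset.filter_subset_filter _ (Finset.filter_subset _ _)))
      (fun v _ x hx => by
        have hx' : β / 2 * n ≤ ((Finset.univ.filter fun y : V => T x y).card : ℝ) := by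
          have := (Finset.mem_filter.1 hx).1
          exact (Finset.mem_filter.1 this).2
        have h1 : (Finset.univ.filter fun y : V => T x y) ⊆
            (Finset.univ.filter fun y : V => T x y ∧ y ∉ W) ∪ W := by
          intro y hy
          by_cases hyW : y ∈ W
          · simp [hyW]
          · simpa [hyW] using hy
        have h2 : ((Finset.univ.filter fun y : V => T x y).card : ℝ) ≤
            (Finset.univ.filter fun y : V => T x y ∧ y ∉ W).card + w := by
          rw [← hWc]
          exact_mod_cast (Finset.card_le_card h1).trans (Finset.card_union_le _ _)
        have : 0 ≤ β * n := by positivity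
        linarith)
    rw [hWc] at this
    have h3 : (β / 8 * N : ℝ) ^ w * ((8 / β) ^ w * Real.exp (-(p * (w * (β / 4 * n))))) =
        (N : ℝ) ^ w * Real.exp (-(p * (w * (β / 4 * n)))) := by
      rw [← mul_assoc, ← mul_pow]
      congr 2
      field_simp
    rw [← h3] at this
    exact le_of_mul_le_mul_left this (by positivity)
  -- In a bad outcome at least `β / 4 * |X|` rich elements fail. Fibres with fewer than `β / 8 * N`
  -- failures account for at most half of these, so at least `β / 8 * n` fibres have many failures,
  -- and `W` is taken among them.
  have hcover : Bad ⊆ ⋃ W ∈ Finset.powersetCard w (Finset.univ : Finset V), Ev W := by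
    intro Γ hΓ
    simp only [Bad, Set.mem_ofPred_eq] at hΓ
    let Fl : Finset X := Rich.filter fun x => ∀ y, T x y → ¬ Γ.Adj (f x) y
    have h1 : Rich ⊆ Fl ∪ Finset.univ.filter fun x => ∃ y, T x y ∧ Γ.Adj (f x) y := by
      intro x hx
      by_cases h : ∃ y, T x y ∧ Γ.Adj (f x) y
      · exact Finset.mem_union_right _ (by simp [h])
      · refine Finset.mem_union_left _ (Finset.mem_filter.2 ⟨hx, ?_⟩)
        push Not at h
        exact h
    have h2 : β / 4 * Fintype.card X ≤ (Fl.card : ℝ) := by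
      have : (Rich.card : ℝ) ≤ Fl.card +
          (Finset.univ.filter fun x => ∃ y, T x y ∧ Γ.Adj (f x) y).card := by
        exact_mod_cast (Finset.card_le_card h1).trans (Finset.card_union_le _ _)
      linarith
    let U : Finset V := Finset.univ.filter fun v =>
      β / 8 * N ≤ (((R v).filter fun x => ∀ y, T x y → ¬ Γ.Adj v y).card : ℝ)
    have h3 : (Fl.card : ℝ) ≤ U.card * N + n * (β / 8 * N) := by
      have e : ∀ v, (Fl.filter fun x => f x = v) =
          (R v).filter fun x => ∀ y, T x y → ¬ Γ.Adj v y := by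
        intro v
        ext x
        simp only [Fl, R, Finset.mem_filter]
        constructor
        · rintro ⟨⟨h, h'⟩, rfl⟩
          exact ⟨⟨h, rfl⟩, h'⟩
        · rintro ⟨⟨h, rfl⟩, h'⟩
          exact ⟨⟨h, h'⟩, rfl⟩
      rw [Finset.card_eq_sum_card_fiberwise (f := f) (t := Finset.univ) (fun _ _ => by simp),
        Nat.cast_sum]
      calc ∑ v : V, ((Fl.filter fun x => f x = v).card : ℝ) ≤
          ∑ v : V, ((if v ∈ U then (N : ℝ) else 0) + β / 8 * N) := by
            refine Finset.sum_le_sum fun v _ => ?_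
            rw [e v]
            split_ifs with hv
            · have : ((R v).filter fun x => ∀ y, T x y → ¬ Γ.Adj v y).card ≤ N := by
                rw [← hf v]
                exact Finset.card_le_card ((Finset.filter_subset _ _).trans
                  (Finset.filter_subset_filter _ (Finset.filter_subset _ _)))
              have h4 : (((R v).filter fun x => ∀ y, T x y → ¬ Γ.Adj v y).card : ℝ) ≤ N := by
                exact_mod_cast this
              have : 0 ≤ β / 8 * N := by positivity
              linarith
            · simp only [U, Finset.mem_filter, Finset.mem_univ, true_and, not_le] at hv
              linarith
        _ = _ := by
            rw [Finset.sum_add_distrib]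
            simp [hnV]
    have h4 : w ≤ U.card := by
      have : β / 8 * n * N ≤ U.card * N := by
        rw [hX] at h2
        linarith
      have := le_of_mul_le_mul_right this hN'
      exact Nat.floor_le_of_le this
    obtain ⟨W, hWU, hWc⟩ := Finset.exists_subset_card_eq h4
    simp only [Set.mem_iUnion]
    refine ⟨W, Finset.mem_powersetCard.2 ⟨Finset.subset_univ _, hWc⟩, fun v hv => ?_⟩
    exact (Finset.mem_filter.1 (hWU hv)).2
  have hbound : (SimpleGraph.binomialRandom V p).real Bad ≤
      2 ^ (Fintype.card V) * ((8 / β) ^ w * Real.exp (-(p * (w * (β / 4 * n))))) := by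
    refine (MeasureTheory.measureReal_mono hcover (MeasureTheory.measure_ne_top _ _)).trans
      ((MeasureTheory.measureReal_biUnion_finset_le _ _).trans
      ((Finset.sum_le_sum hEv).trans ?_))
    rw [Finset.sum_const, nsmul_eq_mul, Finset.card_powersetCard, Finset.card_univ]
    gcongr
    exact_mod_cast Nat.choose_le_two_pow _ _
  refine hbound.trans ?_
  have hp' : C ≤ p * n := by rwa [div_le_iff₀ hn0] at hp
  have h2e : (2 : ℝ) ≤ Real.exp 1 := by linarith [Real.add_one_le_exp (1 : ℝ)]
  have h8e : 8 / β ≤ Real.exp (8 / β) := by linarith [Real.add_one_le_exp (8 / β)]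
  calc (2 : ℝ) ^ (Fintype.card V) * ((8 / β) ^ w * Real.exp (-(p * (w * (β / 4 * n)))))
      ≤ (Real.exp 1) ^ (Fintype.card V) *
        ((Real.exp (8 / β)) ^ w * Real.exp (-(p * (w * (β / 4 * n))))) := by gcongr
    _ = Real.exp (n + w * (8 / β - β / 4 * (p * n))) := by
        rw [← Real.exp_nat_mul, ← Real.exp_nat_mul, ← Real.exp_add, ← Real.exp_add]
        congr 1
        rw [← hnV]
        ring
    _ ≤ _ := by
        rw [Real.exp_le_exp]
        have h1 : β / 4 * C = 8 / β + 16 * (A + 1) / β := by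
          rw [hC]
          field_simp
        have h2 : 8 / β - β / 4 * (p * n) ≤ -(16 * (A + 1) / β) := by
          have : β / 4 * C ≤ β / 4 * (p * n) := by gcongr
          linarith
        have h3 : (w : ℝ) * (8 / β - β / 4 * (p * n)) ≤ w * (-(16 * (A + 1) / β)) := by gcongr
        have h4 : β / 16 * n * (16 * (A + 1) / β) ≤ w * (16 * (A + 1) / β) := by gcongr
        have h5 : β / 16 * n * (16 * (A + 1) / β) = (A + 1) * n := by field_simp
        linarith

open scoped Classical in
theorem card_filter_apply_eq {V : Type*} [Fintype V] {j : ℕ} (i : Fin j) (v : V) :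
    (Finset.univ.filter fun x : Fin j → V => x i = v).card = Fintype.card V ^ (j - 1) := by
  have : (Finset.univ.filter fun x : Fin j → V => x i = v) =
      Fintype.piFinset fun k => if k = i then {v} else Finset.univ := by
    ext x
    simp only [Finset.mem_filter, Finset.mem_univ, true_and, Fintype.mem_piFinset]
    constructor
    · rintro rfl k
      split_ifs with h
      · simp [h]
      · simp
    · intro h
      simpa using h i
  rw [this, Fintype.card_piFinset]
  simp only [apply_ite Finset.card, Finset.card_singleton, Finset.card_univ]
  rw [Finset.prod_ite]
  simp [Finset.filter_ne']

/-- Some sequence of the family `T` is such that any two entries at distance `r` are adjacent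
in `Γ`. -/
def HasLinkedSequence {V : Type*} (r : ℕ) {j : ℕ} (T : Finset (Fin j → V)) (Γ : SimpleGraph V) :
    Prop :=
  ∃ x ∈ T, ∀ a b : Fin j, (b : ℕ) = a + r → Γ.Adj (x a) (x b)

open scoped Classical in
theorem card_filter_snoc_mem {V : Type*} [Fintype V] {j : ℕ} (T : Finset (Fin (j + 1) → V)) :
    (Finset.univ.filter fun z : (Fin j → V) × V =>
      (Fin.snoc (α := fun _ => V) z.1 z.2 : Fin (j + 1) → V) ∈ T).card = T.card := by
  refine Finset.card_bij (fun z _ => (Fin.snoc (α := fun _ => V) z.1 z.2 : Fin (j + 1) → V))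
    (by simp) ?_ ?_
  · rintro ⟨a, b⟩ _ ⟨c, d⟩ _ h
    obtain ⟨rfl, rfl⟩ := Fin.snoc_injective2 h
    rfl
  · intro x hx
    exact ⟨(Fin.init x, x (Fin.last j)), by simpa using hx, by simp⟩

/-- A unit-interval number `q` with `(1 - q) ^ 2 = 1 - p` and `p / 2 ≤ q`. -/
theorem exists_half_density (p : unitInterval) :
    ∃ q : unitInterval, (1 - p : ℝ) = (1 - q) ^ 2 ∧ (p : ℝ) / 2 ≤ q := by
  have h0 : (0 : ℝ) ≤ 1 - p := by linarith [p.2.2]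
  have h1 : √(1 - (p : ℝ)) ≤ 1 - p / 2 := by
    rw [Real.sqrt_le_left (by linarith [p.2.2])]
    nlinarith [sq_nonneg (p : ℝ)]
  refine ⟨⟨1 - √(1 - (p : ℝ)), ?_, ?_⟩, ?_, ?_⟩
  · linarith [p.2.1]
  · linarith [Real.sqrt_nonneg (1 - (p : ℝ))]
  · simp [Real.sq_sqrt h0]
  · simp only
    linarith

-- Fubini for two-round exposure: a section of `E` has measure at most `1` over the bad first-round
-- outcomes `B` and at most `c` elsewhere.
open MeasureTheory in
theorem measureReal_prod_le {Ω : Type*} [MeasurableSpace Ω] [DiscreteMeasurableSpace Ω]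
    [DiscreteMeasurableSpace (Ω × Ω)]
    (μ : Measure Ω) [IsProbabilityMeasure μ] (E : Set (Ω × Ω)) (B : Set Ω) {b c : ℝ} (hc : 0 ≤ c)
    (hB : μ.real B ≤ b) (h : ∀ ω ∉ B, μ.real {ω' | (ω, ω') ∈ E} ≤ c) :
    (μ.prod μ).real E ≤ b + c := by
  have hb : 0 ≤ b := measureReal_nonneg.trans hB
  rw [measureReal_def]
  refine ENNReal.toReal_le_of_le_ofReal (by positivity) ?_
  rw [Measure.prod_apply (MeasurableSet.of_discrete)]
  calc ∫⁻ ω, μ (Prod.mk ω ⁻¹' E) ∂μ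
      ≤ ∫⁻ ω, (B.indicator (fun _ => 1) ω + ENNReal.ofReal c) ∂μ := by
        refine lintegral_mono fun ω => ?_
        by_cases hω : ω ∈ B
        · simp only [hω, Set.indicator_of_mem]
          exact prob_le_one.trans le_self_add
        · simp only [hω, not_false_eq_true, Set.indicator_of_notMem, zero_add]
          have := h ω hω
          rw [measureReal_def] at this
          exact (ENNReal.le_ofReal_iff_toReal_le (measure_ne_top _ _) hc).2 this
    _ = μ B + ENNReal.ofReal c := by
        rw [lintegral_add_right _ measurable_const,
          lintegral_indicator MeasurableSet.of_discrete]
        simp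
    _ ≤ ENNReal.ofReal b + ENNReal.ofReal c := by
        gcongr
        exact (ENNReal.le_ofReal_iff_toReal_le (measure_ne_top _ _) hb).2 hB
    _ = _ := (ENNReal.ofReal_add hb hc).symm

open scoped Classical in
/-- A dense family of sequences contains, with exponentially small failure probability, a sequence
whose entries at distance `r` are joined by edges of a random graph of density `C / n`. -/
theorem exists_binomialRandom_real_not_hasLinkedSequence (r : ℕ) (hr : 0 < r) (j : ℕ) (A : ℝ)
    (hA : 0 < A) (β : ℝ) (hβ : 0 < β) :
    ∃ C : ℝ, 0 < C ∧ ∃ n₀ : ℕ, ∀ (V : Type) [Fintype V] [Nonempty V], n₀ ≤ Fintype.card V →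
      ∀ T : Finset (Fin j → V), β * (Fintype.card V : ℝ) ^ j ≤ (T.card : ℝ) →
      ∀ p : unitInterval, C / Fintype.card V ≤ (p : ℝ) →
        (SimpleGraph.binomialRandom V p).real {Γ | ¬ HasLinkedSequence r T Γ} ≤
          j * Real.exp (-(A * Fintype.card V)) := by
  induction j generalizing β with
  | zero =>
    refine ⟨1, one_pos, 0, fun V _ _ _ T hT p _ => ?_⟩
    have hpos : 0 < T.card := by
      have : (0 : ℝ) < T.card := lt_of_lt_of_le (by simpa using hβ) hT
      exact_mod_cast this
    obtain ⟨x, hx⟩ := Finset.card_pos.1 hpos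
    have : {Γ : SimpleGraph V | ¬ HasLinkedSequence r T Γ} = ∅ := by
      ext Γ
      simp only [Set.mem_ofPred_eq, Set.mem_empty_iff_false, iff_false, not_not]
      exact ⟨x, hx, fun a => a.elim0⟩
    rw [this]
    simp
  | succ j ih =>
    obtain ⟨C₁, hC₁, n₁, H₁⟩ := ih (β / 4) (by positivity)
    obtain ⟨C₂, hC₂, n₂, H₂⟩ := exists_binomialRandom_real_card_lt β A hβ hA
    -- The factor `2` is for splitting `p` into two rounds, each of density `q ≥ p / 2`.
    refine ⟨2 * max C₁ C₂, by positivity, max n₁ n₂, fun V _ _ hn T hT p hp => ?_⟩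
    set n : ℝ := (Fintype.card V : ℝ) with hnV
    have hn0 : 0 < n := by
      rw [hnV]
      exact_mod_cast Fintype.card_pos
    have hcX : (Fintype.card (Fin j → V) : ℝ) = n ^ j := by simp [hnV]
    have hT' : β * Fintype.card (Fin j → V) * Fintype.card V ≤
        ((Finset.univ.filter fun z : (Fin j → V) × V =>
          (Fin.snoc (α := fun _ => V) z.1 z.2 : Fin (j + 1) → V) ∈ T).card : ℝ) := by
      rw [card_filter_snoc_mem, hcX, mul_assoc, ← pow_succ]
      exact hT
    -- For `j < r` the last entry has no predecessor at distance `r`, so it suffices to link a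
    -- prefix that has some extension in `T`.
    rcases Nat.lt_or_ge j r with hjr | hjr
    · let T' : Finset (Fin j → V) := Finset.univ.filter fun x =>
        β / 2 * n ≤ ((Finset.univ.filter fun y : V =>
          (Fin.snoc (α := fun _ => V) x y : Fin (j + 1) → V) ∈ T).card : ℝ)
      have hT'c : β / 4 * n ^ j ≤ (T'.card : ℝ) := by
        have := half_mul_card_le_card_heavy (fun (x : Fin j → V) (y : V) =>
          (Fin.snoc (α := fun _ => V) x y : Fin (j + 1) → V) ∈ T) hβ.le (by convert! hT')
        rw [hcX] at this
        refine le_trans ?_ (this.trans (le_of_eq (by simp only [T']; congr!)))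
        have : 0 ≤ β * n ^ j := by positivity
        linarith
      have h1 := H₁ V (le_trans (le_max_left _ _) hn) T' hT'c p (le_trans (by
        gcongr
        linarith [le_max_left C₁ C₂, le_max_left C₁ C₂]) hp)
      refine (MeasureTheory.measureReal_mono ?_ (MeasureTheory.measure_ne_top _ _)).trans
        (h1.trans ?_)
      · intro Γ hΓ
        simp only [Set.mem_ofPred_eq] at hΓ ⊢
        contrapose! hΓ
        obtain ⟨x, hx, hxΓ⟩ := hΓ
        have hx' := (Finset.mem_filter.1 hx).2
        have hpos : 0 < (Finset.univ.filter fun y : V =>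
            (Fin.snoc (α := fun _ => V) x y : Fin (j + 1) → V) ∈ T).card := by
          have : (0 : ℝ) < _ := lt_of_lt_of_le (by positivity) hx'
          exact_mod_cast this
        obtain ⟨y, hy⟩ := Finset.card_pos.1 hpos
        refine ⟨_, (Finset.mem_filter.1 hy).2, fun a b hab => ?_⟩
        omega
      · gcongr
        simp
    · obtain ⟨q, hq, hpq⟩ := exists_half_density p
      have hqC : max C₁ C₂ / n ≤ q := by
        refine le_trans ?_ hpq
        rw [le_div_iff₀ two_pos]
        refine le_trans (le_of_eq ?_) hp
        ring
      -- The predecessor at distance `r` of the last entry, whose position is `j`.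
      let i : Fin j := ⟨j - r, by omega⟩
      let R : (Fin j → V) → V → Prop := fun x y =>
        (Fin.snoc (α := fun _ => V) x y : Fin (j + 1) → V) ∈ T
      let T' : SimpleGraph V → Finset (Fin j → V) := fun Γ =>
        Finset.univ.filter fun x => ∃ y, R x y ∧ Γ.Adj (x i) y
      have hstep := H₂ V (Fin j → V) (le_trans (le_max_right _ _) hn) (fun x => x i)
        (Fintype.card V ^ (j - 1)) (card_filter_apply_eq i) R (by convert! hT') q (le_trans (by
          gcongr
          exact le_max_right _ _) hqC)
      rw [binomialRandom_eq_map_sup hq, MeasureTheory.measureReal_def,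
        MeasureTheory.Measure.map_apply .of_discrete .of_discrete,
        ← MeasureTheory.measureReal_def]
      refine (measureReal_prod_le _ _ _ (c := j * Real.exp (-(A * n))) (by positivity) hstep
        ?_).trans (le_of_eq ?_)
      -- The first round fixes the dense family `T' Γ₁` of prefixes, and the induction hypothesis is
      -- applied to it with the independent second round.
      · intro Γ₁ hΓ₁
        simp only [Set.mem_ofPred_eq, not_lt] at hΓ₁
        have h1 := H₁ V (le_trans (le_max_left _ _) hn) (T' Γ₁) (by
          rw [← hnV, ← hcX]
          exact hΓ₁.trans (le_of_eq (by simp only [T']; congr!))) q (le_trans (by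
            gcongr
            exact le_max_left _ _) hqC)
        refine (MeasureTheory.measureReal_mono ?_ (MeasureTheory.measure_ne_top _ _)).trans h1
        intro Γ₂ hΓ
        simp only [Set.mem_preimage, Set.mem_ofPred_eq] at hΓ ⊢
        contrapose! hΓ
        obtain ⟨x, hx, hxΓ⟩ := hΓ
        obtain ⟨y, hy, hyΓ⟩ := (Finset.mem_filter.1 hx).2
        refine ⟨_, hy, fun a b hab => ?_⟩
        induction b using Fin.lastCases with
        | last =>
          have ha : a = i.castSucc := by
            ext
            simp only [Fin.val_last] at hab
            simp [i]
            omega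
          rw [ha]
          simp only [Fin.snoc_last, Fin.snoc_castSucc]
          exact Or.inl hyΓ
        | cast b =>
          have ha : a = (⟨a, by have := b.2; simp at hab; omega⟩ : Fin j).castSucc := by
            ext
            simp
          rw [ha]
          simp only [Fin.snoc_castSucc]
          exact Or.inr (hxΓ _ _ (by simpa using hab))
      · push_cast
        ring

/-! ### Choice of the reservoir -/

open MeasureTheory ProbabilityTheory unitInterval in
open scoped Classical in
/-- Hoeffding's inequality for weighted sums of independent Bernoulli variables, in the form needed
to find a good outcome: finitely many such sums can be kept small at the same time. -/
theorem exists_finset_forall_sum_lt {V κ : Type*} [Fintype V] [Fintype κ] (p : I)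
    (w : κ → V → ℝ) (hw : ∀ k v, |w k v| ≤ 1) {t : ℝ} (ht : 0 ≤ t)
    (hlt : Fintype.card κ * Real.exp (-t ^ 2 / (2 * Fintype.card V)) < 1) :
    ∃ s : Finset V, ∀ k, ∑ v, w k v * ((if v ∈ s then 1 else 0) - p) < t := by
  let ν : Measure Prop := toNNReal p • Measure.dirac True + toNNReal (σ p) • Measure.dirac False
  have hν : IsProbabilityMeasure ν := inferInstance
  let X : Prop → ℝ := fun P => if P then 1 else 0
  have hX : ∫ P, X P ∂ν = p := by
    have hi : ∀ P, Integrable X (Measure.dirac P) := fun P => integrable_dirac (by simp)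
    simp only [ν]
    rw [integral_add_measure ((hi _).smul_measure_nnreal) ((hi _).smul_measure_nnreal),
      integral_smul_nnreal_measure, integral_smul_nnreal_measure]
    simp [X, NNReal.smul_def]
  let μ : Measure (V → Prop) := Measure.pi fun _ => ν
  have hk : ∀ k, μ.real {ω | t ≤ ∑ v, w k v * (X (ω v) - p)} ≤
      Real.exp (-t ^ 2 / (2 * Fintype.card V)) := by
    intro k
    have hind : iIndepFun (fun v (ω : V → Prop) => w k v * (X (ω v) - p)) μ :=
      iIndepFun_pi (X := fun v P => w k v * (X P - p)) fun v => Measurable.of_discrete.aemeasurable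
    have hsub : ∀ v ∈ (Finset.univ : Finset V),
        HasSubgaussianMGF (fun ω : V → Prop => w k v * (X (ω v) - p)) 1 μ := by
      intro v _
      have h1 : HasSubgaussianMGF (fun P => w k v * (X P - p)) 1 ν := by
        -- An interval of length `2` gives the sub-Gaussian parameter `(2 / 2) ^ 2 = 1`.
        have := hasSubgaussianMGF_of_mem_Icc (μ := ν) (X := fun P => w k v * X P) (a := -1) (b := 1)
          Measurable.of_discrete.aemeasurable (.of_forall fun P => by
            have := abs_le.1 (hw k v)
            simp only [X]
            split_ifs
            · simpa using this
            · simp)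
        rw [integral_const_mul, hX] at this
        convert this using 2
        · ring
        · ext
          norm_num
      have hmap : μ.map (fun ω => ω v) = ν := (measurePreserving_eval (fun _ => ν) v).map_eq
      rw [← hmap] at h1
      exact HasSubgaussianMGF.of_map (Y := fun ω : V → Prop => ω v)
        (measurable_pi_apply v).aemeasurable h1
    have := HasSubgaussianMGF.measure_sum_ge_le_of_iIndepFun hind hsub ht
    simpa using this
  have hU : μ.real (⋃ k, {ω | t ≤ ∑ v, w k v * (X (ω v) - p)}) < 1 := by
    refine lt_of_le_of_lt ((measureReal_iUnion_fintype_le _).trans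
      (Finset.sum_le_sum fun k _ => hk k)) ?_
    simpa using hlt
  have hne : (⋃ k, {ω : V → Prop | t ≤ ∑ v, w k v * (X (ω v) - p)}) ≠ Set.univ := by
    intro h
    rw [h] at hU
    simp at hU
  obtain ⟨ω, hω⟩ := (Set.ne_univ_iff_exists_notMem _).1 hne
  simp only [Set.mem_iUnion, Set.mem_ofPred_eq, not_exists, not_le] at hω
  refine ⟨Finset.univ.filter fun v => ω v, fun k => ?_⟩
  simpa [X] using hω k

theorem eventually_mul_exp_lt (η : ℝ) (hη : 0 < η) :
    ∀ᶠ n : ℕ in atTop, ((n : ℝ) + 1) * Real.exp (-(η * n)) < 1 := by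
  have h1 : Tendsto (fun x : ℝ => x * Real.exp (-(η * x))) atTop (𝓝 0) := by
    have := Real.tendsto_pow_mul_exp_neg_atTop_nhds_zero 1
    have h2 := (this.comp (tendsto_id.const_mul_atTop hη)).const_mul (1 / η)
    simp only [mul_zero] at h2
    refine h2.congr fun x => ?_
    simp only [Function.comp, id, pow_one]
    field_simp
  have h2 : Tendsto (fun x : ℝ => Real.exp (-(η * x))) atTop (𝓝 0) :=
    Real.tendsto_exp_neg_atTop_nhds_zero.comp (tendsto_id.const_mul_atTop hη)
  have h3 := ((h1.add h2).comp tendsto_natCast_atTop_atTop).eventually_lt_const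
    (show (0 : ℝ) + 0 < 1 by norm_num)
  filter_upwards [h3] with n hn
  simp only [Function.comp] at hn
  linarith

/-- For every family of `n` subsets of an `n`-set there is a set of size `⌊ρ n⌋` that contains
at most about the proportion `ρ` of each of them. -/
theorem exists_card_inter_le (ρ κ : ℝ) (hρ₀ : 0 < ρ) (hρ₁ : ρ < 1) (hκ : 0 < κ) :
    ∀ᶠ n : ℕ in atTop, ∀ B : Fin n → Finset (Fin n), ∃ R : Finset (Fin n),
      R.card = ⌊ρ * n⌋₊ ∧ ∀ v, ((R ∩ B v).card : ℝ) ≤ ρ * (B v).card + κ * n := by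
  classical
  -- Sampling with density `ρ + η ≤ 1` leaves room to shrink the sample to exactly `⌊ρ n⌋` elements.
  -- The excess density and the deviation cost at most `η * n` each, together at most `κ * n`.
  set η := min (1 - ρ) (κ / 2) with hη
  have hη0 : 0 < η := lt_min (by linarith) (by linarith)
  have hη1 : η ≤ 1 - ρ := min_le_left _ _
  have hη2 : η ≤ κ / 2 := min_le_right _ _
  let p : unitInterval := ⟨ρ + η, by linarith, by linarith⟩
  filter_upwards [eventually_mul_exp_lt (η ^ 2 / 2) (by positivity), eventually_gt_atTop 0]
    with n hn hn0 B
  have hn0' : (0 : ℝ) < n := by exact_mod_cast hn0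
  -- The weight `-1` bounds the size of the sample from below; the indicators bound its
  -- intersections with the sets `B u` from above.
  let w : Option (Fin n) → Fin n → ℝ := fun k v =>
    match k with
    | none => -1
    | some u => if v ∈ B u then 1 else 0
  obtain ⟨s, hs⟩ := exists_finset_forall_sum_lt p w (by
    rintro (_ | u) v
    · simp [w]
    · simp only [w]
      split_ifs <;> simp) (t := η * n) (by positivity) (by
    simp only [Fintype.card_option, Fintype.card_fin, Nat.cast_add, Nat.cast_one]
    convert hn using 3
    field_simp)
  have h1 : (ρ * n : ℝ) ≤ s.card := by
    have := hs none
    simp only [w, neg_one_mul, neg_sub, Finset.sum_sub_distrib, Finset.sum_const, Finset.card_univ,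
      Fintype.card_fin, nsmul_eq_mul, p] at this
    simp at this
    linarith
  obtain ⟨R, hRs, hR⟩ := Finset.exists_subset_card_eq (Nat.floor_le_of_le h1)
  refine ⟨R, hR, fun u => ?_⟩
  have h2 : ((s ∩ B u).card : ℝ) - (B u).card * (ρ + η) < η * n := by
    have := hs (some u)
    simp only [w, ite_mul, one_mul, zero_mul, Finset.sum_ite_mem, Finset.univ_inter,
      Finset.sum_sub_distrib, Finset.sum_const, nsmul_eq_mul, p] at this
    simp only [mul_one] at this
    rw [show s ∩ B u = B u ∩ s from Finset.inter_comm _ _]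
    convert! this
  have h3 : ((R ∩ B u).card : ℝ) ≤ (s ∩ B u).card := by
    exact_mod_cast Finset.card_le_card (Finset.inter_subset_inter_right hRs)
  have h4 : ((B u).card : ℝ) ≤ n := by
    exact_mod_cast (Finset.card_le_univ _).trans (by simp)
  have h5 : ((B u).card : ℝ) * η ≤ n * η := by gcongr
  have h6 : n * η ≤ n * (κ / 2) := by gcongr
  linarith

/-! ### Union bound and conclusion -/

-- A union bound over the sets `S` and all pairs of sequences `K`, `K'`. For fixed `S`, `K`, `K'`
-- the family of sparse walks depends on `G` alone, so it is fixed before `Γ` is exposed.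
open scoped Classical in
theorem binomialRandom_real_not_isReservoir_le {V : Type} [Fintype V] [DecidableEq V] (k : ℕ)
    (ε : ℝ) (G : SimpleGraph V) (R : Finset V) (p : unitInterval) (b : ℝ) (hb : 0 ≤ b)
    (h : ∀ S ⊆ R, (S.card : ℝ) ≤ ε * R.card / 4 → ∀ K K' : Fin (k + 1) → V,
      (SimpleGraph.binomialRandom V p).real {Γ | ¬ HasLinkedSequence (k + 1)
        (Finset.univ.filter fun x : Fin ((k + 1) * 2 ^ (k + 1)) → V =>
          IsSparseWalk G (R \ S) K K' x) Γ} ≤ b) :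
    (SimpleGraph.binomialRandom V p).real {Γ | IsReservoir k ε G (G ⊔ Γ) R}ᶜ ≤
      2 ^ Fintype.card V * (Fintype.card V : ℝ) ^ (2 * (k + 1)) * b := by
  let J : Finset (Finset V × (Fin (k + 1) → V) × (Fin (k + 1) → V)) :=
    Finset.univ.filter fun z => z.1 ⊆ R ∧ (z.1.card : ℝ) ≤ ε * R.card / 4
  let E : Finset V × (Fin (k + 1) → V) × (Fin (k + 1) → V) → Set (SimpleGraph V) := fun z =>
    {Γ | ¬ HasLinkedSequence (k + 1)
        (Finset.univ.filter fun x : Fin ((k + 1) * 2 ^ (k + 1)) → V =>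
          IsSparseWalk G (R \ z.1) z.2.1 z.2.2 x) Γ}
  have hsub : {Γ | IsReservoir k ε G (G ⊔ Γ) R}ᶜ ⊆ ⋃ z ∈ J, E z := by
    intro Γ hΓ
    contrapose! hΓ
    simp only [Set.mem_iUnion, not_exists, E, Set.mem_ofPred_eq, not_not] at hΓ
    simp only [Set.mem_compl_iff, Set.mem_ofPred_eq, not_not]
    intro S hS hSc K K' hK hK' hKR hKR' hKK'
    obtain ⟨x, hx, hxΓ⟩ := hΓ (S, K, K') (Finset.mem_filter.2 ⟨Finset.mem_univ _, hS, hSc⟩)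
    refine (Finset.mem_filter.1 hx).2.isConnectedThrough hxΓ hK hK' ?_ ?_ hKK' ?_
    · exact fun i hi => hKR i (Finset.sdiff_subset hi)
    · exact fun i hi => hKR' i (Finset.sdiff_subset hi)
    · exact Nat.le_mul_of_pos_right _ (by positivity)
  refine (MeasureTheory.measureReal_mono hsub (MeasureTheory.measure_ne_top _ _)).trans
    ((MeasureTheory.measureReal_biUnion_finset_le _ _).trans ?_)
  have hE : ∀ z ∈ J, (SimpleGraph.binomialRandom V p).real (E z) ≤ b := by
    intro z hz
    obtain ⟨hz1, hz2⟩ := (Finset.mem_filter.1 hz).2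
    exact h z.1 hz1 hz2 z.2.1 z.2.2
  refine (Finset.sum_le_sum hE).trans ?_
  rw [Finset.sum_const, nsmul_eq_mul]
  gcongr
  have : J.card ≤ 2 ^ Fintype.card V * Fintype.card V ^ (2 * (k + 1)) := by
    refine (Finset.card_le_univ _).trans (le_of_eq ?_)
    simp [two_mul, pow_add]
  exact_mod_cast this

open scoped Classical in
/-- Removing few vertices from a set that meets every non-neighbourhood in the expected proportion
leaves many common neighbours for any `r` vertices. -/
theorem le_card_common_neighbors {V : Type*} [DecidableEq V] (G : SimpleGraph V)
    (R S : Finset V) {r : ℕ} (d : ℝ)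
    (hd : ∀ v, ((R.filter fun u => ¬ G.Adj v u).card : ℝ) ≤ d) (w : Fin r → V) :
    (R.card : ℝ) - S.card - r * d ≤
      (((R \ S).filter fun v => ∀ j, G.Adj (w j) v).card : ℝ) := by
  have h1 : R ⊆ (((R \ S).filter fun v => ∀ j, G.Adj (w j) v) ∪ S) ∪
      Finset.univ.biUnion fun j => R.filter fun u => ¬ G.Adj (w j) u := by
    intro v hv
    by_cases hS : v ∈ S
    · simp [hS]
    by_cases h : ∀ j, G.Adj (w j) v
    · exact Finset.mem_union_left _ (Finset.mem_union_left _ (by simp [hv, hS, h]))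
    · push Not at h
      obtain ⟨j, hj⟩ := h
      exact Finset.mem_union_right _ (Finset.mem_biUnion.2 ⟨j, by simp, by simp [hv, hj]⟩)
  have h2 : (R.card : ℝ) ≤ (((R \ S).filter fun v => ∀ j, G.Adj (w j) v).card + S.card : ℝ) +
      ∑ j, ((R.filter fun u => ¬ G.Adj (w j) u).card : ℝ) := by
    have := (Finset.card_le_card h1).trans ((Finset.card_union_le _ _).trans
      (Nat.add_le_add (Finset.card_union_le _ _) Finset.card_biUnion_le))
    exact_mod_cast this
  have h3 : ∑ j, ((R.filter fun u => ¬ G.Adj (w j) u).card : ℝ) ≤ r * d := by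
    refine (Finset.sum_le_sum fun j _ => hd (w j)).trans (le_of_eq ?_)
    simp
  linarith

open scoped Classical in
theorem card_filter_not_adj {V : Type*} [Fintype V] (G : SimpleGraph V)
    [DecidableRel G.Adj] (v : V) :
    ((Finset.univ.filter fun u => ¬ G.Adj v u).card : ℝ) = Fintype.card V - G.degree v := by
  have h := Finset.card_filter_add_card_filter_not (s := (Finset.univ : Finset V))
    (fun u => G.Adj v u)
  have h2 : (Finset.univ.filter fun u => G.Adj v u).card = G.degree v := by
    rw [← SimpleGraph.card_neighborFinset_eq_degree, SimpleGraph.neighborFinset_eq_filter]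
  rw [h2, Finset.card_univ] at h
  rw [← h]
  push_cast
  ring

/-- Since `2 ^ n ≤ exp n`, a polynomial times `exp (-n)` remains. -/
theorem tendsto_union_bound (r L : ℕ) :
    Tendsto (fun n : ℕ => 2 ^ n * (n : ℝ) ^ (2 * r) * (L * Real.exp (-(2 * n)))) atTop (𝓝 0) := by
  have h1 := ((Real.tendsto_pow_mul_exp_neg_atTop_nhds_zero (2 * r)).comp
    tendsto_natCast_atTop_atTop).const_mul (L : ℝ)
  rw [mul_zero] at h1
  refine squeeze_zero (fun n => by positivity) (fun n => ?_) h1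
  have h2e : (2 : ℝ) ≤ Real.exp 1 := by linarith [Real.add_one_le_exp (1 : ℝ)]
  have h2 : (2 : ℝ) ^ n ≤ Real.exp n := by
    calc (2 : ℝ) ^ n ≤ (Real.exp 1) ^ n := by gcongr
      _ = Real.exp n := by rw [← Real.exp_nat_mul, mul_one]
  have h3 : Real.exp (-(2 * (n : ℝ))) = Real.exp (-n) * Real.exp (-n) := by
    rw [← Real.exp_add]
    congr 1
    ring
  have h4 : Real.exp n * Real.exp (-(n : ℝ)) = 1 := by rw [← Real.exp_add]; simp
  simp only [Function.comp]
  rw [h3]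
  calc 2 ^ n * (n : ℝ) ^ (2 * r) * (L * (Real.exp (-n) * Real.exp (-n)))
      ≤ Real.exp n * (n : ℝ) ^ (2 * r) * (L * (Real.exp (-n) * Real.exp (-n))) := by gcongr
    _ = L * ((n : ℝ) ^ (2 * r) * Real.exp (-n)) * (Real.exp n * Real.exp (-n)) := by ring
    _ = _ := by rw [h4, mul_one]

theorem proposition2p2 (k : ℕ) (ε γ : ℝ) (hε : 0 < ε) (hγ₀ : 0 < γ) (hγ₁ : γ < 1) :
    ∃ C : ℝ, 1 < C ∧
      ∀ (G : (n : ℕ) → SimpleGraph (Fin n)) [∀ n, DecidableRel (G n).Adj],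
        (∀ᶠ n : ℕ in atTop,
          ((k : ℝ) / ((k : ℝ) + 1) + ε) * (n : ℝ) ≤ ((G n).minDegree : ℝ)) →
        ∃ R : (n : ℕ) → Finset (Fin n),
          (∀ n : ℕ, (R n).card = ⌊γ ^ 2 * (n : ℝ)⌋₊) ∧
          ∀ p : ℕ → unitInterval,
            (∀ᶠ n : ℕ in atTop, C / (n : ℝ) ≤ (p n : ℝ)) →
            Tendsto
              (fun n : ℕ => SimpleGraph.binomialRandom (Fin n) (p n)
                {Γ : SimpleGraph (Fin n) | IsReservoir k ε (G n) (G n ⊔ Γ) (R n)})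
              atTop (𝓝 1) := by
  classical
  set c₀ : ℝ := ε * γ ^ 2 / 4 with hc₀
  obtain ⟨β, hβ, n₁, H₁⟩ := exists_dense_isSparseWalk (k + 1) (2 ^ (k + 1)) (Nat.succ_pos k)
    (two_mul_le_two_pow (Nat.succ_pos k)) c₀ (by positivity)
  obtain ⟨C, hC, n₂, H₂⟩ := exists_binomialRandom_real_not_hasLinkedSequence (k + 1)
    (Nat.succ_pos k) ((k + 1) * 2 ^ (k + 1)) 2 two_pos β hβ
  refine ⟨max C 2, lt_of_lt_of_le one_lt_two (le_max_right _ _), fun G _ hG => ?_⟩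
  have hγ2 : γ ^ 2 < 1 := by nlinarith
  -- The proportion `γ ^ 2` of the largest possible non-neighbourhood, plus the sampling error.
  let d : ℕ → ℝ := fun n => γ ^ 2 * ((1 / ((k : ℝ) + 1) - ε) * n) + ε * γ ^ 2 / 4 * n
  have hk : (0 : ℝ) < (k : ℝ) + 1 := by positivity
  have hgood : ∀ᶠ n : ℕ in atTop, ∃ R : Finset (Fin n), R.card = ⌊γ ^ 2 * (n : ℝ)⌋₊ ∧
      ∀ v, ((R.filter fun u => ¬ (G n).Adj v u).card : ℝ) ≤ d n := by
    filter_upwards [exists_card_inter_le (γ ^ 2) (ε * γ ^ 2 / 4) (by positivity) hγ2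
      (by positivity), hG] with n hn hGn
    obtain ⟨R, hR, hRB⟩ := hn fun v => Finset.univ.filter fun u => ¬ (G n).Adj v u
    refine ⟨R, hR, fun v => ?_⟩
    have h1 : (R.filter fun u => ¬ (G n).Adj v u) =
        R ∩ Finset.univ.filter fun u => ¬ (G n).Adj v u := by
      ext u
      simp
    have h2 : ((Finset.univ.filter fun u => ¬ (G n).Adj v u).card : ℝ) ≤
        (1 / ((k : ℝ) + 1) - ε) * n := by
      have h3 := card_filter_not_adj (G n) v
      have h4 : ((G n).minDegree : ℝ) ≤ (G n).degree v := by
        exact_mod_cast (G n).minDegree_le_degree v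
      have h5 : (k : ℝ) / (k + 1) = 1 - 1 / (k + 1) := by field_simp; ring
      rw [h5] at hGn
      rw [Fintype.card_fin] at h3
      have h6 : ((Finset.univ.filter fun u => ¬ (G n).Adj v u).card : ℝ) = n - (G n).degree v := by
        rw [← h3]
      rw [h6]
      linarith
    rw [h1]
    refine (hRB v).trans ?_
    simp only [d]
    gcongr
  -- `R` needs the right size for every `n`, but good sets are known only for large `n`; elsewhere
  -- any set of that size serves. The choice precedes `p`.
  have hex : ∀ n : ℕ, ∃ R : Finset (Fin n), R.card = ⌊γ ^ 2 * (n : ℝ)⌋₊ ∧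
      ((∃ R : Finset (Fin n), R.card = ⌊γ ^ 2 * (n : ℝ)⌋₊ ∧
        ∀ v, ((R.filter fun u => ¬ (G n).Adj v u).card : ℝ) ≤ d n) →
        ∀ v, ((R.filter fun u => ¬ (G n).Adj v u).card : ℝ) ≤ d n) := by
    intro n
    by_cases h : ∃ R : Finset (Fin n), R.card = ⌊γ ^ 2 * (n : ℝ)⌋₊ ∧
        ∀ v, ((R.filter fun u => ¬ (G n).Adj v u).card : ℝ) ≤ d n
    · obtain ⟨R, hR, hRd⟩ := h
      exact ⟨R, hR, fun _ => hRd⟩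
    · have hle : ⌊γ ^ 2 * (n : ℝ)⌋₊ ≤ (Finset.univ : Finset (Fin n)).card := by
        rw [Finset.card_univ, Fintype.card_fin]
        refine Nat.floor_le_of_le ?_
        have : (0 : ℝ) ≤ n := by positivity
        nlinarith
      obtain ⟨R, -, hR⟩ := Finset.exists_subset_card_eq hle
      exact ⟨R, hR, fun h' => absurd h' h⟩
  choose R hRc hRd using hex
  refine ⟨R, hRc, fun p hp => ?_⟩
  set L := (k + 1) * 2 ^ (k + 1) with hL
  let b : ℕ → ℝ := fun n => 2 ^ n * (n : ℝ) ^ (2 * (k + 1)) * (L * Real.exp (-(2 * n)))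
  have hb : Tendsto b atTop (𝓝 0) := tendsto_union_bound (k + 1) L
  have hmain : ∀ᶠ n : ℕ in atTop, (SimpleGraph.binomialRandom (Fin n) (p n)).real
      {Γ : SimpleGraph (Fin n) | IsReservoir k ε (G n) (G n ⊔ Γ) (R n)}ᶜ ≤ b n := by
    filter_upwards [hgood, hp, eventually_ge_atTop n₁, eventually_ge_atTop n₂,
      eventually_gt_atTop 0, eventually_ge_atTop ⌈4 / (ε * γ ^ 2)⌉₊] with n hgn hpn hn1 hn2 hn0 hn4
    have hne : Nonempty (Fin n) := ⟨⟨0, hn0⟩⟩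
    have hn0' : (0 : ℝ) < n := by exact_mod_cast hn0
    have h4 : 4 ≤ n * (ε * γ ^ 2) := by
      have := (Nat.le_ceil _).trans (Nat.cast_le (α := ℝ).2 hn4)
      rwa [div_le_iff₀ (by positivity)] at this
    have := binomialRandom_real_not_isReservoir_le k ε (G n) (R n) (p n)
      (L * Real.exp (-(2 * n))) (by positivity) (by
      intro S _ hSc K K'
      have hT := H₁ (Fin n) (by simpa using hn1) (G n) (R n \ S) (by
        intro w
        refine le_trans ?_ (le_card_common_neighbors (G n) (R n) S (d n) (fun v => by
          convert hRd n hgn v) w)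
        have h5 : γ ^ 2 * n - 1 ≤ ((R n).card : ℝ) := by
          rw [hRc n]
          exact (Nat.sub_one_lt_floor _).le
        have h6 : ((R n).card : ℝ) ≤ γ ^ 2 * n := by
          rw [hRc n]
          exact Nat.floor_le (by positivity)
        -- The gain is at least `3 / 4 * ε * γ ^ 2 * n`. Removing `S` costs at most a third of it,
        -- and rounding `|R|` costs at most `1 ≤ ε * γ ^ 2 * n / 4`, which leaves `c₀ * n`.
        have h7 : ((k + 1 : ℕ) : ℝ) * d n = γ ^ 2 * n - ((k : ℝ) + 1) * (3 / 4 * (ε * γ ^ 2 * n)) := by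
          simp only [d]
          push_cast
          field_simp
          ring
        have h8 : ε * (R n).card ≤ ε * (γ ^ 2 * n) := by gcongr
        have h9 : (1 : ℝ) * (3 / 4 * (ε * γ ^ 2 * n)) ≤ ((k : ℝ) + 1) * (3 / 4 * (ε * γ ^ 2 * n)) := by
          gcongr
          linarith [(Nat.cast_nonneg k : (0 : ℝ) ≤ k)]
        rw [h7, Fintype.card_fin, hc₀]
        nlinarith) K K'
      have := H₂ (Fin n) (by simpa using hn2) _ hT (p n) (by
        rw [Fintype.card_fin]
        refine le_trans ?_ hpn
        gcongr
        exact le_max_left _ _)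
      rw [Fintype.card_fin] at this
      convert! this)
    rw [Fintype.card_fin] at this
    exact this
  have hlow : Tendsto (fun n => ENNReal.ofReal (1 - b n)) atTop (𝓝 1) := by
    have := ENNReal.tendsto_ofReal (hb.const_sub 1)
    simpa using this
  refine tendsto_of_tendsto_of_tendsto_of_le_of_le' hlow tendsto_const_nhds ?_
    (.of_forall fun n => MeasureTheory.prob_le_one)
  filter_upwards [hmain] with n hn
  rw [MeasureTheory.probReal_compl_eq_one_sub .of_discrete] at hn
  refine ENNReal.ofReal_le_of_le_toReal ?_
  rw [← MeasureTheory.measureReal_def]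
  linarith
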